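/- Let $G\subset \mathrm{PSL}_2(\mathbb R)$ be a discrete group such that the hyperbolic 2-orbifold $S=\mathbb H/G$ has finite area. Let $T_1S=(T_1\mathbb H)/G$ be its unit tangent bundle, where $T_1\mathbb H=\mathbb H\times S^1$, let $G_t$ be the geodesic flow on $T_1S$, and for $v\in T_1S$ let $\alpha_v(t)$ be the base point of $G_t(v)$. Let $\mu$ be the normalized Liouville measure on $T_1S$, that is, the measure whose lift to $T_1\mathbb H$ is $\frac{1}{2\pi\,\mathrm{area}(S)}\,dA\,d\phi$, with $dA$ the hyperbolic area and $d\phi$ the angle. Let $\mathcal E\subset T_1S$ be the set of vectors $v$ whose forward orbit $\{G_t(v): t>0\}$ is dense in $T_1S$. Let $\gamma$ be a simple closed geodesic on $S$ of length $l(\gamma)$ (not passing through cone points of $S$), and put $R=\log\coth\frac{l(\gamma)}{4}$. Let $0<r<R$, and let $A_r$ be one of the two half-collars of width $r$ about $\gamma$: the image in $S$ of the set of points that lie on one chosen side of a lift $\tilde\gamma\subset\mathbb H$ of $\gamma$ (a complete geodesic) at distance less than $r$ from $\tilde\gamma$. Let $\mathcal L^*(\gamma)$ be the set of $v\in T_1S$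 with base point on $\gamma$ for which there is $\tau_0>0$ with $\alpha_v(t)\in A_r$ for $0<t<\tau_0$, and let $\mathcal L(\gamma)=\mathcal L^*(\gamma)\cap\mathcal E$. For $0\le\varepsilon<R-r$ define the thickened section $$\mathcal L_\varepsilon(\gamma)=\{G_t(v): t\in[0,\varepsilon],\ v\in\mathcal L(\gamma)\}.$$ Then $\mathcal L_\varepsilon(\gamma)$ is a Borel set and $$\mu(\mathcal L_\varepsilon(\gamma))=\frac{\varepsilon\, l(\gamma)}{\pi\,\mathrm{area}(S)}.$$ -/

import Mathlib

open scoped MatrixGroups UpperHalfPlane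

noncomputable section

namespace HypSurface

open MeasureTheory Set Complex ComplexConjugate

/-! ### The action of `PSL(2, ℝ)` on the hyperbolic plane -/

/-- Möbius transformations: `PSL(2, ℝ)` acts on the upper half-plane through any lift to
`SL(2, ℝ)`, since the center `{1, -1}` acts trivially. -/
instance instMulActionPSL : MulAction PSL(2, ℝ) ℍ :=
  MulAction.compHom ℍ (QuotientGroup.lift (Subgroup.center SL(2, ℝ))
    (MulAction.toPermHom SL(2, ℝ) ℍ) (by
      intro g hg
      obtain ⟨r, hr, hg⟩ := Matrix.SpecialLinearGroup.mem_center_iff.mp hg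
      have hr0 : (r : ℂ) ≠ 0 := by
        rintro h
        have : r = 0 := by exact_mod_cast h
        simp [this] at hr
      ext z
      have h00 : g 0 0 = r := by rw [← hg]; simp
      have h01 : g 0 1 = 0 := by rw [← hg]; simp
      have h10 : g 1 0 = 0 := by rw [← hg]; simp
      have h11 : g 1 1 = r := by rw [← hg]; simp
      simp [MulAction.toPermHom_apply, UpperHalfPlane.coe_specialLinearGroup_apply, h00, h01,
        h10, h11, hr0]))

theorem mk_smul (g : SL(2, ℝ)) (z : ℍ) : ((g : PSL(2, ℝ)) • z : ℍ) = g • z := rfl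

/-! ### The unit tangent bundle of the hyperbolic plane and its geodesic flow -/

/-- The unit tangent bundle `T₁ℍ = ℍ × S¹`: the pair `(z, u)` is the tangent vector `im z * u` at
`z`, which has hyperbolic length `1`. -/
def UnitTangent : Type := ℍ × Circle

/-- The base point of a unit tangent vector. -/
def base (v : UnitTangent) : ℍ := Prod.fst v

/-- The Euclidean direction of a unit tangent vector. -/
def dir (v : UnitTangent) : Circle := Prod.snd v

/-- The unit tangent vector with given base point and direction. -/
def vec (z : ℍ) (u : Circle) : UnitTangent := (z, u)

@[simp] theorem base_vec (z : ℍ) (u : Circle) : base (vec z u) = z := rfl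
@[simp] theorem dir_vec (z : ℍ) (u : Circle) : dir (vec z u) = u := rfl

theorem UnitTangent.ext {v w : UnitTangent} (h₁ : base v = base w)
    (h₂ : (dir v : ℂ) = dir w) : v = w := Prod.ext h₁ (Circle.ext h₂)

instance : TopologicalSpace UnitTangent := inferInstanceAs (TopologicalSpace (ℍ × Circle))
instance : MeasurableSpace UnitTangent := borel UnitTangent
instance : BorelSpace UnitTangent := ⟨rfl⟩

/-- The denominator `c z + d` of the Möbius transformation `z ↦ (a z + b) / (c z + d)`. -/
def den (g : SL(2, ℝ)) (z : ℍ) : ℂ := (g 1 0 : ℂ) * z + (g 1 1 : ℂ)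

theorem den_ne_zero (g : SL(2, ℝ)) (z : ℍ) : den g z ≠ 0 :=
  UpperHalfPlane.denom_ne_zero (g : GL (Fin 2) ℝ) z

theorem coe_smul (g : SL(2, ℝ)) (z : ℍ) :
    ((g • z : ℍ) : ℂ) = ((g 0 0 : ℂ) * z + (g 0 1 : ℂ)) / den g z :=
  UpperHalfPlane.coe_specialLinearGroup_apply g z

theorem den_mul (g h : SL(2, ℝ)) (z : ℍ) : den (g * h) z = den g (h • z) * den h z := by
  have := den_ne_zero h z
  rw [den, den, coe_smul, add_mul, mul_assoc, div_mul_cancel₀ _ this, den]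
  simp [Matrix.mul_apply, Fin.sum_univ_two]
  ring

/-- The derivative action of `SL(2, ℝ)` on unit tangent vectors. The derivative of
`z ↦ (a z + b) / (c z + d)` is `1 / (c z + d)²`, so that the direction is multiplied by
`conj (c z + d) / (c z + d)`. -/
instance instMulActionSLTangent : MulAction SL(2, ℝ) UnitTangent where
  smul g v := vec (g • base v) (dir v * Circle.ofConjDivSelf (den g (base v)) (den_ne_zero _ _))
  one_smul v := by
    refine UnitTangent.ext (one_smul SL(2, ℝ) (base v)) ?_
    change (dir v : ℂ) * (conj (den 1 (base v)) / den 1 (base v)) = dir v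
    simp [den]
  mul_smul g h v := by
    refine UnitTangent.ext (mul_smul g h (base v)) ?_
    change (dir v : ℂ) * (conj (den (g * h) (base v)) / den (g * h) (base v)) =
      (dir v : ℂ) * (conj (den h (base v)) / den h (base v)) *
        (conj (den g (h • base v)) / den g (h • base v))
    rw [den_mul, map_mul]
    have := den_ne_zero h (base v)
    have := den_ne_zero g (h • base v)
    field_simp

theorem base_smul_SL (g : SL(2, ℝ)) (v : UnitTangent) : base (g • v) = g • base v := rfl

theorem dir_smul_SL (g : SL(2, ℝ)) (v : UnitTangent) :
    (dir (g • v) : ℂ) = dir v * (conj (den g (base v)) / den g (base v)) := rfl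

/-- The derivative action of `PSL(2, ℝ)` on the unit tangent bundle. -/
instance instMulActionPSLTangent : MulAction PSL(2, ℝ) UnitTangent :=
  MulAction.compHom UnitTangent (QuotientGroup.lift (Subgroup.center SL(2, ℝ))
    (MulAction.toPermHom SL(2, ℝ) UnitTangent) (by
      intro g hg
      obtain ⟨r, hr, hg'⟩ := Matrix.SpecialLinearGroup.mem_center_iff.mp hg
      have hr0 : (r : ℂ) ≠ 0 := by
        rintro h
        have : r = 0 := by exact_mod_cast h
        simp [this] at hr
      have h10 : g 1 0 = 0 := by rw [← hg']; simp
      have h11 : g 1 1 = r := by rw [← hg']; simp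
      have hz : ∀ z : ℍ, g • z = z := fun z => by
        rw [← mk_smul, (QuotientGroup.eq_one_iff g).mpr hg, one_smul]
      ext v
      refine UnitTangent.ext (hz (base v)) ?_
      change (dir v : ℂ) * (conj (den g (base v)) / den g (base v)) = dir v
      simp [den, h10, h11, hr0]))

theorem mk_smul_tangent (g : SL(2, ℝ)) (v : UnitTangent) :
    ((g : PSL(2, ℝ)) • v : UnitTangent) = g • v := rfl

theorem base_smul (g : PSL(2, ℝ)) (v : UnitTangent) : base (g • v) = g • base v := by
  induction g using QuotientGroup.induction_on with
  | H g => rfl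

/-- The denominator in the formula for the geodesic flow. -/
def flowDen (t : ℝ) (u : Circle) : ℂ := Real.cosh (t / 2) + I * u * Real.sinh (t / 2)

theorem flowDen_ne_zero (t : ℝ) (u : Circle) : flowDen t u ≠ 0 := by
  intro h
  have h1 : ((Real.cosh (t / 2) : ℝ) : ℂ) = -(I * u * Real.sinh (t / 2)) :=
    eq_neg_of_add_eq_zero_left h
  have h2 := congrArg (fun z : ℂ => ‖z‖) h1
  simp only [norm_neg, norm_mul, Complex.norm_I, Circle.norm_coe, Complex.norm_real,
    Real.norm_eq_abs, one_mul] at h2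
  have h3 := Real.cosh_sq (t / 2)
  have h4 := sq_abs (Real.cosh (t / 2))
  have h5 := sq_abs (Real.sinh (t / 2))
  rw [h2] at h4
  linarith

/-- The numerator in the formula for the geodesic flow. -/
def flowNum (t : ℝ) (z : ℍ) (u : Circle) : ℂ :=
  z * Real.cosh (t / 2) + I * u * conj (z : ℂ) * Real.sinh (t / 2)

theorem flowNum_div_im (t : ℝ) (z : ℍ) (u : Circle) :
    (flowNum t z u / flowDen t u).im = z.im / Complex.normSq (flowDen t u) := by
  have hD := flowDen_ne_zero t u
  have hD' : Complex.normSq (flowDen t u) ≠ 0 := by simpa using hD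
  have hu : (u : ℂ).re ^ 2 + (u : ℂ).im ^ 2 = 1 := by
    have := Circle.normSq_coe u
    rw [Complex.normSq_apply] at this
    linarith
  have hc := Real.cosh_sq (t / 2)
  rw [Complex.div_im, div_sub_div_same]
  congr 1
  simp only [flowNum, flowDen, Complex.add_im, Complex.add_re, Complex.mul_re, Complex.mul_im,
    Complex.ofReal_re, Complex.ofReal_im, Complex.I_re, Complex.I_im, Complex.conj_re,
    Complex.conj_im, UpperHalfPlane.coe_im, UpperHalfPlane.coe_re]
  linear_combination z.im * hc - z.im * Real.sinh (t / 2) ^ 2 * hu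

/-- The geodesic flow on `T₁ℍ`. The vector `v = (z, u)` is moved for time `t` along the unit speed
geodesic that it generates, whose position and direction at time `t` are
`(z cosh (t/2) + i u conj(z) sinh (t/2)) / D` and `u conj(D) / D` with
`D = cosh (t/2) + i u sinh (t/2)`; see `hasDerivAt_base_flow` and `dist_base_flow`. -/
def flow (t : ℝ) (v : UnitTangent) : UnitTangent :=
  vec ⟨flowNum t (base v) (dir v) / flowDen t (dir v), by
      rw [flowNum_div_im]
      exact div_pos (base v).im_pos (Complex.normSq_pos.mpr (flowDen_ne_zero t _))⟩
    (dir v * Circle.ofConjDivSelf (flowDen t (dir v)) (flowDen_ne_zero t _))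

theorem coe_base_flow (t : ℝ) (v : UnitTangent) :
    (base (flow t v) : ℂ) = flowNum t (base v) (dir v) / flowDen t (dir v) := rfl

theorem coe_dir_flow (t : ℝ) (v : UnitTangent) :
    (dir (flow t v) : ℂ) = dir v * (conj (flowDen t (dir v)) / flowDen t (dir v)) := rfl

theorem conj_dir (u : Circle) : (u : ℂ) * conj (u : ℂ) = 1 := by
  rw [Complex.mul_conj, Circle.normSq_coe]; simp

theorem cosh_sq_complex (x : ℝ) :
    ((Real.cosh x : ℝ) : ℂ) ^ 2 = ((Real.sinh x : ℝ) : ℂ) ^ 2 + 1 := by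
  exact_mod_cast Real.cosh_sq x

theorem conj_flowDen (t : ℝ) (u : Circle) :
    conj (flowDen t u) = Real.cosh (t / 2) - I * conj (u : ℂ) * Real.sinh (t / 2) := by
  simp only [flowDen, map_add, map_mul, Complex.conj_ofReal, Complex.conj_I]; ring

theorem flow_zero (v : UnitTangent) : flow 0 v = v := by
  refine UnitTangent.ext (UpperHalfPlane.ext ?_) ?_
  · rw [coe_base_flow]; simp [flowNum, flowDen]
  · rw [coe_dir_flow]; simp [flowDen]

theorem flowDen_add (s t : ℝ) (v : UnitTangent) :
    flowDen (s + t) (dir v) = flowDen s (dir (flow t v)) * flowDen t (dir v) := by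
  have hD := flowDen_ne_zero t (dir v)
  rw [flowDen, flowDen, coe_dir_flow, add_mul]
  rw [show I * ((dir v : ℂ) * (conj (flowDen t (dir v)) / flowDen t (dir v))) *
      ((Real.sinh (s / 2) : ℝ) : ℂ) * flowDen t (dir v) =
      I * (dir v : ℂ) * conj (flowDen t (dir v)) * ((Real.sinh (s / 2) : ℝ) : ℂ) by field_simp]
  rw [conj_flowDen, flowDen, add_div, Real.cosh_add, Real.sinh_add]
  push_cast
  linear_combination (Complex.sinh (s / 2) * Complex.sinh (t / 2)) *
    (I ^ 2 * conj_dir (dir v) + Complex.I_sq)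

theorem flowNum_add (s t : ℝ) (v : UnitTangent) :
    flowNum (s + t) (base v) (dir v) =
      flowNum s (base (flow t v)) (dir (flow t v)) * flowDen t (dir v) := by
  have hD := flowDen_ne_zero t (dir v)
  have hD' : conj (flowDen t (dir v)) ≠ 0 := by simpa using hD
  have h1 : flowNum s (base (flow t v)) (dir (flow t v)) * flowDen t (dir v) =
      flowNum t (base v) (dir v) * Real.cosh (s / 2) +
        I * dir v * conj (flowNum t (base v) (dir v)) * Real.sinh (s / 2) := by
    rw [flowNum, coe_base_flow, coe_dir_flow, map_div₀]
    field_simp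
  have h2 : conj (flowNum t (base v) (dir v)) = conj (base v : ℂ) * Real.cosh (t / 2) -
      I * conj (dir v : ℂ) * (base v : ℂ) * Real.sinh (t / 2) := by
    simp only [flowNum, map_add, map_mul, Complex.conj_ofReal, Complex.conj_I, Complex.conj_conj]
    ring
  rw [h1, h2, flowNum, flowNum, add_div, Real.cosh_add, Real.sinh_add]
  push_cast
  linear_combination ((base v : ℂ) * Complex.sinh (s / 2) * Complex.sinh (t / 2)) *
    (I ^ 2 * conj_dir (dir v) + Complex.I_sq)

/-- The geodesic flow is a flow. -/
theorem flow_add (s t : ℝ) (v : UnitTangent) : flow (s + t) v = flow s (flow t v) := by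
  have h1 := flowDen_ne_zero t (dir v)
  have h2 := flowDen_ne_zero s (dir (flow t v))
  refine UnitTangent.ext (UpperHalfPlane.ext ?_) ?_
  · rw [coe_base_flow, coe_base_flow, flowDen_add, flowNum_add]
    field_simp
  · rw [coe_dir_flow, coe_dir_flow s, flowDen_add, coe_dir_flow t, map_mul]
    field_simp

/-- The base curve of an orbit of the geodesic flow is parametrized by hyperbolic arc length, and
minimizes length: it is a unit speed geodesic. -/
theorem dist_base_flow (s t : ℝ) (v : UnitTangent) :
    dist (base (flow s v)) (base (flow t v)) = |s - t| := by
  have key : ∀ (t : ℝ) (v : UnitTangent), dist (base v) (base (flow t v)) = |t| := by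
    intro t v
    have hD := flowDen_ne_zero t (dir v)
    have hD' : 0 < ‖flowDen t (dir v)‖ := norm_pos_iff.mpr hD
    have hy := (base v).im_pos
    have him : (base (flow t v)).im = (base v).im / ‖flowDen t (dir v)‖ ^ 2 := by
      rw [← UpperHalfPlane.coe_im, coe_base_flow, flowNum_div_im, Complex.normSq_eq_norm_sq]
    have hsub : (base v : ℂ) - base (flow t v) =
        I * dir v * Real.sinh (t / 2) * (2 * (base v).im * I) / flowDen t (dir v) := by
      have h := Complex.sub_conj (base v : ℂ)
      rw [coe_base_flow, eq_div_iff hD, sub_mul, div_mul_cancel₀ _ hD, flowNum, flowDen]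
      rw [UpperHalfPlane.coe_im] at h
      push_cast at h ⊢
      linear_combination (I * dir v * Complex.sinh (t / 2)) * h
    rw [UpperHalfPlane.dist_eq_iff_eq_sinh, him, Complex.dist_eq, hsub]
    rw [show (base v).im * ((base v).im / ‖flowDen t (dir v)‖ ^ 2) =
      ((base v).im / ‖flowDen t (dir v)‖) ^ 2 by ring, Real.sqrt_sq (by positivity)]
    simp only [norm_div, norm_mul, Complex.norm_I, Circle.norm_coe, Complex.norm_real,
      Real.norm_eq_abs, abs_of_pos hy, Complex.norm_ofNat, one_mul, mul_one]
    rw [show |t| / 2 = |t / 2| by rw [abs_div]; norm_num, ← Real.abs_sinh]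
    field_simp
  have h := key (t - s) (flow s v)
  rw [← flow_add, sub_add_cancel] at h
  rw [h, abs_sub_comm]

/-- The velocity of the base curve of the orbit of `v` at time `t` is the vector `flow t v`. -/
theorem hasDerivAt_base_flow (t : ℝ) (v : UnitTangent) :
    HasDerivAt (fun s => (base (flow s v) : ℂ))
      ((base (flow t v)).im * (dir (flow t v) : ℂ)) t := by
  have hD := flowDen_ne_zero t (dir v)
  have hD' : conj (flowDen t (dir v)) ≠ 0 := by simpa using hD
  have h2 : HasDerivAt (fun s : ℝ => s / 2) (1 / 2) t := (hasDerivAt_id t).div_const 2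
  have hc : HasDerivAt (fun s : ℝ => ((Real.cosh (s / 2) : ℝ) : ℂ))
      ((Real.sinh (t / 2) * (1 / 2) : ℝ) : ℂ) t := h2.cosh.ofReal_comp
  have hs : HasDerivAt (fun s : ℝ => ((Real.sinh (s / 2) : ℝ) : ℂ))
      ((Real.cosh (t / 2) * (1 / 2) : ℝ) : ℂ) t := h2.sinh.ofReal_comp
  have hN := (hc.const_mul (base v : ℂ)).add (hs.const_mul (I * dir v * conj (base v : ℂ)))
  have hE := hc.add (hs.const_mul (I * (dir v : ℂ)))
  have h := hN.div hE hD
  refine HasDerivAt.congr_deriv h ?_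
  have him : (base (flow t v)).im = (base v).im / Complex.normSq (flowDen t (dir v)) := by
    rw [← UpperHalfPlane.coe_im, coe_base_flow, flowNum_div_im]
  have hz := Complex.sub_conj (base v : ℂ)
  rw [UpperHalfPlane.coe_im] at hz
  have hr : ((base (flow t v)).im * (dir (flow t v) : ℂ)) =
      (base v).im * dir v / flowDen t (dir v) ^ 2 := by
    rw [him, coe_dir_flow]
    push_cast
    rw [← Complex.mul_conj]
    field_simp
  rw [hr]
  simp only [Pi.add_apply]
  change _ / flowDen t (dir v) ^ 2 = _
  congr 1
  have hcs := cosh_sq_complex (t / 2)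
  push_cast at hz hcs ⊢
  linear_combination (I * dir v * (conj (base v : ℂ) - base v) / 2) * hcs -
    (I * dir v / 2) * hz - (dir v * (base v).im : ℂ) * Complex.I_sq

/-- Isometries commute with the geodesic flow. -/
theorem flow_smul (t : ℝ) (g : PSL(2, ℝ)) (v : UnitTangent) : flow t (g • v) = g • flow t v := by
  induction g using QuotientGroup.induction_on with
  | H g =>
    rw [mk_smul_tangent, mk_smul_tangent]
    have hj := den_ne_zero g (base v)
    have hj' : conj (den g (base v)) ≠ 0 := by simpa using hj
    have hD := flowDen_ne_zero t (dir v)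
    have hk := den_ne_zero g (base (flow t v))
    have hE := flowDen_ne_zero t (dir (g • v))
    have hw : (base (flow t v) : ℂ) * flowDen t (dir v) = flowNum t (base v) (dir v) :=
      div_mul_cancel₀ _ hD
    rw [flowDen, flowNum] at hw
    have e1 : flowDen t (dir (g • v)) * den g (base v) =
        den g (base (flow t v)) * flowDen t (dir v) := by
      have h1 : flowDen t (dir (g • v)) * den g (base v) =
          den g (base v) * Real.cosh (t / 2) +
            I * dir v * conj (den g (base v)) * Real.sinh (t / 2) := by
        rw [flowDen, dir_smul_SL]; field_simp
      rw [h1]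
      simp only [den, map_add, map_mul, Complex.conj_ofReal, flowDen]
      linear_combination (-(g 1 0 : ℂ)) * hw
    have e2 : flowNum t (base (g • v)) (dir (g • v)) * den g (base v) =
        ((g 0 0 : ℂ) * base (flow t v) + (g 0 1 : ℂ)) * flowDen t (dir v) := by
      have h1 : flowNum t (base (g • v)) (dir (g • v)) * den g (base v) =
          ((g 0 0 : ℂ) * base v + (g 0 1 : ℂ)) * Real.cosh (t / 2) +
            I * dir v * ((g 0 0 : ℂ) * conj (base v : ℂ) + (g 0 1 : ℂ)) * Real.sinh (t / 2) := by
        rw [flowNum, dir_smul_SL, base_smul_SL, coe_smul, map_div₀]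
        simp only [map_add, map_mul, Complex.conj_ofReal]
        field_simp
      rw [h1, flowDen]
      linear_combination (-(g 0 0 : ℂ)) * hw
    have e3 : flowDen t (dir (g • v)) =
        den g (base (flow t v)) * flowDen t (dir v) / den g (base v) := by
      rw [← e1]; field_simp
    refine UnitTangent.ext (UpperHalfPlane.ext ?_) ?_
    · rw [base_smul_SL, coe_smul, coe_base_flow t (g • v), div_eq_div_iff hE hk]
      refine mul_right_cancel₀ hj ?_
      linear_combination den g (base (flow t v)) * e2 -
        ((g 0 0 : ℂ) * base (flow t v) + (g 0 1 : ℂ)) * e1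
    · rw [dir_smul_SL, coe_dir_flow, e3, dir_smul_SL, coe_dir_flow]
      simp only [map_div₀, map_mul]
      field_simp

/-! ### Quotient measures -/

/-- The measure on the orbit space `X / G` that is induced by a `G`-invariant measure `m` on `X`:
the smallest measure that is at least `m U` on the image of every measurable set `U` that the
projection maps injectively (and likewise for the parts of `U`). -/
def quotientMeasure (G : Type*) {X : Type*} [Group G] [MulAction G X] [MeasurableSpace X]
    (m : Measure X) : Measure (MulAction.orbitRel.Quotient G X) :=
  ⨆ (U : Set X) (_ : MeasurableSet U)
    (_ : InjOn (Quotient.mk (MulAction.orbitRel G X)) U),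
    (m.restrict U).map (Quotient.mk (MulAction.orbitRel G X))

/-- The defining property of the quotient measure: the projection preserves the measure of every
measurable set that it maps injectively. -/
theorem quotientMeasure_image {G X : Type*} [Group G] [Countable G] [MulAction G X]
    [MeasurableSpace X] [MeasurableConstSMul G X] (m : Measure X) [SMulInvariantMeasure G X m]
    {U : Set X} (hU : MeasurableSet U) (hinj : InjOn (Quotient.mk (MulAction.orbitRel G X)) U) :
    quotientMeasure G m (Quotient.mk (MulAction.orbitRel G X) '' U) = m U := by
  set π := Quotient.mk (MulAction.orbitRel G X) with hπ_def
  have hπ : Measurable π := @measurable_quotient_mk' X _ (MulAction.orbitRel G X)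
  have hpre : π ⁻¹' (π '' U) = ⋃ g : G, (fun x => g • x) ⁻¹' U := by
    ext x
    simp only [mem_preimage, mem_image, mem_iUnion]
    constructor
    · rintro ⟨y, hy, hyx⟩
      obtain ⟨g, hg⟩ := Quotient.exact hyx
      exact ⟨g, by simpa using (show g • x = y from hg) ▸ hy⟩
    · rintro ⟨g, hg⟩
      exact ⟨g • x, hg, Quotient.sound ⟨g, rfl⟩⟩
  have hB : MeasurableSet (π '' U) := by
    change MeasurableSet (π ⁻¹' (π '' U))
    rw [hpre]
    exact MeasurableSet.iUnion fun g => measurable_const_smul g hU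
  apply le_antisymm
  · set ν : Measure (MulAction.orbitRel.Quotient G X) := (m.restrict U).map π with hν
    have hle : quotientMeasure G m ≤ ν + (⊤ : Measure _).restrict (π '' U)ᶜ := by
      refine iSup_le fun V => iSup_le fun hV => iSup_le fun hVinj => ?_
      refine Measure.le_iff.mpr fun C hC => ?_
      rw [← measure_inter_add_sdiff C hB, Measure.add_apply]
      refine add_le_add ?_ ?_
      · -- the part over the image of `U`
        obtain ⟨f, hf⟩ := exists_surjective_nat G
        rw [Measure.map_apply hπ (hC.inter hB), hν, Measure.map_apply hπ hC,
          Measure.restrict_apply (hπ (hC.inter hB)), Measure.restrict_apply (hπ hC)]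
        set W : ℕ → Set X := fun n => (π ⁻¹' C ∩ V) ∩ (fun x => f n • x) ⁻¹' U with hW
        have hWm : ∀ n, MeasurableSet (W n) := fun n =>
          ((hπ hC).inter hV).inter (measurable_const_smul (f n) hU)
        have hcover : π ⁻¹' (C ∩ π '' U) ∩ V = ⋃ n, disjointed W n := by
          rw [iUnion_disjointed, preimage_inter, hpre]
          ext x
          simp only [mem_inter_iff, mem_iUnion, hW, mem_preimage]
          constructor
          · rintro ⟨⟨h1, g, hg⟩, h2⟩
            obtain ⟨n, rfl⟩ := hf g
            exact ⟨n, ⟨h1, h2⟩, hg⟩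
          · rintro ⟨n, ⟨h1, h2⟩, hg⟩
            exact ⟨⟨h1, f n, hg⟩, h2⟩
        have hdm : ∀ n, MeasurableSet (disjointed W n) := fun n => MeasurableSet.disjointed hWm n
        set D : ℕ → Set X := fun n => (fun x => (f n)⁻¹ • x) ⁻¹' disjointed W n with hD
        have hDm : ∀ n, MeasurableSet (D n) := fun n => measurable_const_smul _ (hdm n)
        have hDdisj : Pairwise (Function.onFun Disjoint D) := by
          intro i j hij
          refine Set.disjoint_left.mpr fun x hi hj => ?_
          have hi' : (f i)⁻¹ • x ∈ disjointed W i := hi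
          have hj' : (f j)⁻¹ • x ∈ disjointed W j := hj
          have heq : (f i)⁻¹ • x = (f j)⁻¹ • x := by
            refine hVinj (disjointed_subset W i hi').1.2 (disjointed_subset W j hj').1.2 ?_
            exact Quotient.sound ⟨(f i)⁻¹ * f j, by simp [mul_smul]⟩
          rw [heq] at hi'
          exact Set.disjoint_left.mp (disjoint_disjointed W hij) hi' hj'
        calc m (π ⁻¹' (C ∩ π '' U) ∩ V) = ∑' n, m (disjointed W n) := by
              rw [hcover, measure_iUnion (disjoint_disjointed W) hdm]
          _ = ∑' n, m (D n) := by
              congr 1; ext n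
              exact (measure_preimage_smul m _ _).symm
          _ = m (⋃ n, D n) := (measure_iUnion hDdisj hDm).symm
          _ ≤ m (π ⁻¹' C ∩ U) := by
              refine measure_mono (iUnion_subset fun n x hx => ?_)
              have hx' := disjointed_subset W n (show (f n)⁻¹ • x ∈ disjointed W n from hx)
              refine ⟨?_, by simpa using hx'.2⟩
              have h1 : π ((f n)⁻¹ • x) = π x := Quotient.sound ⟨(f n)⁻¹, rfl⟩
              have h2 : π ((f n)⁻¹ • x) ∈ C := hx'.1.1
              rwa [h1] at h2
      · rw [Measure.restrict_apply hC, ← sdiff_eq]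
        exact (le_top : (m.restrict V).map π ≤ ⊤) _
    refine (hle _).trans ?_
    rw [Measure.add_apply, Measure.restrict_apply hB, inter_compl_self, measure_empty, add_zero,
      hν, Measure.map_apply hπ hB]
    exact (Measure.restrict_apply_univ U) ▸ measure_mono (subset_univ _)
  · have h : (m.restrict U).map π ≤ quotientMeasure G m :=
      le_iSup_of_le U (le_iSup_of_le hU (le_iSup_of_le hinj le_rfl))
    refine le_trans ?_ (h _)
    rw [Measure.map_apply hπ hB, Measure.restrict_apply (hπ hB),
      inter_eq_self_of_subset_right (subset_preimage_image π U)]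

/-! ### The surface, its unit tangent bundle, and the invariant measure -/

variable (G : Subgroup PSL(2, ℝ))

/-- The hyperbolic 2-orbifold `S = ℍ / G`. -/
abbrev Surface : Type := MulAction.orbitRel.Quotient G ℍ

/-- The covering projection `ℍ → S`. -/
def proj (z : ℍ) : Surface G := Quotient.mk _ z

/-- The unit tangent bundle `T₁S = T₁ℍ / G`. -/
abbrev SurfaceTangent : Type := MulAction.orbitRel.Quotient G UnitTangent

/-- The projection `T₁ℍ → T₁S`. -/
def tangentProj (v : UnitTangent) : SurfaceTangent G := Quotient.mk _ v

/-- The base point map `T₁S → S`. -/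
def surfaceBase : SurfaceTangent G → Surface G :=
  Quotient.map base (by
    rintro v w ⟨g, rfl⟩
    exact ⟨g, (base_smul g w).symm⟩)

/-- The geodesic flow on `T₁S`; the ray determined by `w` is `t ↦ surfaceBase G (surfaceFlow G t w)`
for `t ≥ 0`. -/
def surfaceFlow (t : ℝ) : SurfaceTangent G → SurfaceTangent G :=
  Quotient.map (flow t) (by
    rintro v w ⟨g, rfl⟩
    exact ⟨g, (flow_smul t g w).symm⟩)

/-- The hyperbolic area of `S` (`volume` on `ℍ` is the hyperbolic area `dx dy / y²`). -/
def area : ENNReal := quotientMeasure G (volume : Measure ℍ) univ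

/-- The measure `dA dφ` on `T₁ℍ = ℍ × S¹`, where `φ` is the angle in the circle. -/
def liouvillePlane : Measure UnitTangent :=
  ((volume : Measure ℍ).prod
      ((volume : Measure ℝ).restrict (Ioc (-Real.pi) Real.pi))).map
    (fun q : ℍ × ℝ => vec q.1 (Circle.exp q.2))

/-- The Liouville measure on `T₁S`, normalized to be a probability measure: its lift to `T₁ℍ` is
`dA dφ / (2 π area(S))`. -/
def liouville : Measure (SurfaceTangent G) :=
  (ENNReal.ofReal (2 * Real.pi) * area G)⁻¹ • quotientMeasure G liouvillePlane

/-- The set of unit vectors on `S` whose forward orbit is dense in `T₁S`. -/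
def denseOrbits : Set (SurfaceTangent G) :=
  {w | Dense ((fun t => surfaceFlow G t w) '' Ioi 0)}

/-! ### Simple closed geodesics, collars, and cross-sections -/

/-- The complete oriented geodesic in `ℍ` generated by `v`, as a set of points. -/
def axis (v : UnitTangent) : Set ℍ := range fun t => base (flow t v)

/-- The geodesic on `S` generated by `v`, as a set of points. -/
def geodesic (v : UnitTangent) : Set (Surface G) := proj G '' axis v

/-- The geodesic on `S` generated by `v` is a simple closed geodesic of length `l`: it closes up
smoothly after time `l`, has no self-intersections before that time, and does not
pass through cone points. -/
structure IsSimpleClosedGeodesic (v : UnitTangent) (l : ℝ) : Prop where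
  length_pos : 0 < l
  closed : surfaceFlow G l (tangentProj G v) = tangentProj G v
  simple : InjOn (fun t => proj G (base (flow t v))) (Ico 0 l)
  regular : ∀ t, ∀ g ∈ G, g • base (flow t v) = base (flow t v) → g = 1

/-- The half-plane bounded by the geodesic `axis v` that contains the point `p` (off the
geodesic). -/
def halfPlane (v : UnitTangent) (p : ℍ) : Set ℍ := connectedComponentIn (axis v)ᶜ p

/-- The half-collar of width `r` about the geodesic generated by `v`, on the side given by `p`:
the image in `S` of the points of the half-plane at distance less than `r` from the lifted
geodesic. -/
def halfCollar (v : UnitTangent) (p : ℍ) (r : ℝ) : Set (Surface G) :=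
  proj G '' (halfPlane v p ∩ Metric.thickening r (axis v))

/-- The unit vectors on `S` based on the geodesic generated by `v` that point into the
half-collar. -/
def inwardVectors (v : UnitTangent) (p : ℍ) (r : ℝ) : Set (SurfaceTangent G) :=
  {w | surfaceBase G w ∈ geodesic G v ∧ ∃ τ₀ > 0, ∀ t : ℝ, 0 < t → t < τ₀ →
    surfaceBase G (surfaceFlow G t w) ∈ halfCollar G v p r}

/-- The cross-section of the geodesic flow: the inward vectors with dense forward orbit. -/
def crossSection (v : UnitTangent) (p : ℍ) (r : ℝ) : Set (SurfaceTangent G) :=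
  inwardVectors G v p r ∩ denseOrbits G

/-- The thickened section: the cross-section moved by the geodesic flow for times in `[0, ε]`. -/
def thickenedSection (v : UnitTangent) (p : ℍ) (r ε : ℝ) : Set (SurfaceTangent G) :=
  {w | ∃ t ∈ Icc 0 ε, ∃ w₀ ∈ crossSection G v p r, w = surfaceFlow G t w₀}

/-- The collar width `log coth (l / 4)` of a simple closed geodesic of length `l`. -/
def collarWidth (l : ℝ) : ℝ := Real.log (Real.cosh (l / 4) / Real.sinh (l / 4))

end HypSurface

end

/-!
The proof works on `T₁ℍ`, identified with `PSL(2, ℝ)` through the orbit map of the vector `upI`, the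
upward vector at `i` (`orbitHomeo`). Under this identification the geodesic flow is right
multiplication by the diagonal matrices `diagA t` (`flow_smul_upI`), and `liouvillePlane` is a Haar
measure. The group is unimodular, so the flow preserves the Liouville measure.

*Almost every forward orbit is dense* (`ae_mem_liftedDenseOrbits`). Ergodicity is not needed, only
the following topological form of Hopf's argument. Let `K ⊆ PSL(2, ℝ)` be closed, invariant under
`G` on the left and under `a = diagA 1` on the right. By Poincaré recurrence for `a`, almost every
point of `K` has its whole orbit in `K`. If `u` is an upper unipotent matrix, then the forward
orbits of `x` and `x * u` are asymptotic; hence for `x` in `K` with `x * u` recurrent, `x * u`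
belongs to `K`. The backward orbits and recurrence for `a⁻¹` serve in the same way for the lower
unipotent matrices. Upper and lower unipotents generate, so almost every `x ∈ K` has `x * p ∈ K` for
all `p` in a countable dense set, and `K` is null or everything. This is applied to
the complement of the set of vectors whose forward orbit meets a given open set.

*The collar lemma* (`mem_zpowers_of_dist_lt`). An isometry `k` carries the imaginary axis to the
lift of the closed geodesic (`IsCollarFrame`). If an element of `G` moved the axis to a disjoint
geodesic at distance less than `collarWidth l`, then this translate and its image under the
translation by `l` along the axis would cross, which contradicts simplicity. Discreteness excludes
translates that share an endpoint with the axis. So an element of `G` that maps the axis to a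
geodesic closer than the collar width is a translation by a multiple of `l` along it. Consequently

* the inward vectors are exactly those that point to the chosen side of the axis
  (`IsCollarFrame.mem_inwardVectors_iff`), since another sheet of the half-collar does not come
  within reach;
* the thickened section is the injective image of a flow box over a segment of length `l`
  (`IsCollarFrame.thickenedSection_eq` and `IsCollarFrame.injOn_flowBox`).

*The volume of a flow box* (`liouvillePlane_flowBox_univ`). In the coordinates `X = x / y` and
`η = log y` the area form is `dX dη`. The vectors of direction `φ` in the box, with `cos φ > 0`, have
`0 ≤ X ≤ cos φ sinh ε / (cosh ε + sin φ sinh ε)`, and for each such `X` the coordinate `η` ranges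
over an interval of length `l`. Integration over `φ` gives `2 l ε`. By density of almost all orbits
the restriction to `denseOrbits` does not change the measure, and division by `2 π area(S)` gives
the formula.
-/

open scoped Topology Pointwise

noncomputable section

namespace HypSurface

open MeasureTheory Set Complex ComplexConjugate

/-! ### Topology of the unit tangent bundle and of `PSL(2, ℝ)` -/

/-- The unit tangent bundle is homeomorphic to `ℍ × S¹` by definition. -/
def tangentHomeo : UnitTangent ≃ₜ ℍ × Circle := Homeomorph.refl _

instance : T2Space UnitTangent := inferInstanceAs (T2Space (ℍ × Circle))
instance : SecondCountableTopology UnitTangent :=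
  inferInstanceAs (SecondCountableTopology (ℍ × Circle))
instance : LocallyCompactSpace UnitTangent := inferInstanceAs (LocallyCompactSpace (ℍ × Circle))

theorem continuous_base : Continuous base := continuous_fst.comp tangentHomeo.continuous

theorem continuous_dir : Continuous dir := continuous_snd.comp tangentHomeo.continuous

theorem continuous_coe_dir : Continuous fun v => (dir v : ℂ) :=
  continuous_subtype_val.comp continuous_dir

theorem continuous_vec_iff {X : Type*} [TopologicalSpace X] {f : X → UnitTangent} :
    Continuous f ↔ Continuous (fun x => (base (f x) : ℂ)) ∧
      Continuous fun x => (dir (f x) : ℂ) := by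
  refine ⟨fun h => ⟨UpperHalfPlane.continuous_coe.comp (continuous_base.comp h),
    continuous_coe_dir.comp h⟩, fun ⟨h₁, h₂⟩ => ?_⟩
  have h₁' : Continuous fun x => base (f x) :=
    UpperHalfPlane.isEmbedding_coe.continuous_iff.mpr h₁
  have h₂' : Continuous fun x => dir (f x) := Topology.IsInducing.subtypeVal.continuous_iff.mpr h₂
  exact tangentHomeo.symm.continuous.comp (h₁'.prodMk h₂')

theorem continuous_entry (i j : Fin 2) : Continuous fun g : SL(2, ℝ) => (g i j : ℂ) :=
  Complex.continuous_ofReal.comp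
    ((continuous_apply j).comp ((continuous_apply i).comp continuous_subtype_val))

instance : ContinuousSMul SL(2, ℝ) UnitTangent where
  continuous_smul := by
    have hz : Continuous fun q : SL(2, ℝ) × UnitTangent => (base q.2 : ℂ) :=
      UpperHalfPlane.continuous_coe.comp (continuous_base.comp continuous_snd)
    have hg (i j : Fin 2) : Continuous fun q : SL(2, ℝ) × UnitTangent => (q.1 i j : ℂ) :=
      (continuous_entry i j).comp continuous_fst
    have hd : Continuous fun q : SL(2, ℝ) × UnitTangent => den q.1 (base q.2) :=
      ((hg 1 0).mul hz).add (hg 1 1)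
    refine continuous_vec_iff.mpr ⟨?_, ?_⟩
    · simp only [base_smul_SL, coe_smul]
      exact (((hg 0 0).mul hz).add (hg 0 1)).div hd fun q => den_ne_zero _ _
    · simp only [dir_smul_SL]
      exact (continuous_coe_dir.comp continuous_snd).mul
        ((Complex.continuous_conj.comp hd).div hd fun q => den_ne_zero _ _)

theorem isOpenQuotientMap_mk_prod (X : Type*) [TopologicalSpace X] :
    IsOpenQuotientMap fun q : SL(2, ℝ) × X => ((q.1 : PSL(2, ℝ)), q.2) :=
  QuotientGroup.isOpenQuotientMap_mk.prodMap (IsOpenQuotientMap.id)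

instance : ContinuousSMul PSL(2, ℝ) UnitTangent where
  continuous_smul :=
    (isOpenQuotientMap_mk_prod UnitTangent).isQuotientMap.continuous_iff.mpr
      (continuous_smul (M := SL(2, ℝ)) (X := UnitTangent))

instance : ContinuousSMul PSL(2, ℝ) ℍ where
  continuous_smul :=
    (isOpenQuotientMap_mk_prod ℍ).isQuotientMap.continuous_iff.mpr
      (continuous_smul (M := SL(2, ℝ)) (X := ℍ))

instance : SigmaCompactSpace SL(2, ℝ) :=
  haveI : SigmaCompactSpace (Matrix (Fin 2) (Fin 2) ℝ) :=
    inferInstanceAs (SigmaCompactSpace (Fin 2 → Fin 2 → ℝ))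
  Matrix.SpecialLinearGroup.isClosedEmbedding_val.sigmaCompactSpace

instance : SigmaCompactSpace PSL(2, ℝ) where
  isSigmaCompact_univ := by
    rw [← QuotientGroup.mk_surjective.range_eq, ← image_univ]
    exact isSigmaCompact_univ.image QuotientGroup.continuous_mk

/-! ### The unit tangent bundle as a torsor of `PSL(2, ℝ)` -/

/-- The upward unit tangent vector at `i`, the reference vector of the unit tangent bundle. -/
def upI : UnitTangent := vec UpperHalfPlane.I ⟨Complex.I, by simp [Submonoid.unitSphere]⟩

@[simp] theorem base_upI : base upI = UpperHalfPlane.I := rfl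
@[simp] theorem coe_dir_upI : (dir upI : ℂ) = Complex.I := rfl

/-- The diagonal matrix that moves the reference vector for time `t` along its geodesic. -/
def diagA (t : ℝ) : SL(2, ℝ) :=
  ⟨!![Real.exp (t / 2), 0; 0, Real.exp (-(t / 2))], by simp [← Real.exp_add]⟩

/-- The upper unipotent matrix with entry `s`. -/
def upper (s : ℝ) : SL(2, ℝ) := ⟨!![1, s; 0, 1], by simp⟩

/-- The lower unipotent matrix with entry `s`. -/
def lower (s : ℝ) : SL(2, ℝ) := ⟨!![1, 0; s, 1], by simp⟩

/-- The rotation matrix with angle `φ`. As an isometry of the hyperbolic plane it fixes `i` and rotates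
the tangent plane there by `2 φ`. -/
def rotK (φ : ℝ) : SL(2, ℝ) :=
  ⟨!![Real.cos φ, Real.sin φ; -Real.sin φ, Real.cos φ], by
    simp [← sq, Real.cos_sq_add_sin_sq]⟩

@[simp] theorem upper_apply (s : ℝ) (i j : Fin 2) : upper s i j = !![1, s; 0, 1] i j := rfl
@[simp] theorem lower_apply (s : ℝ) (i j : Fin 2) : lower s i j = !![1, 0; s, 1] i j := rfl
@[simp] theorem diagA_apply (t : ℝ) (i j : Fin 2) :
    diagA t i j = !![Real.exp (t / 2), 0; 0, Real.exp (-(t / 2))] i j := rfl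
@[simp] theorem rotK_apply (φ : ℝ) (i j : Fin 2) :
    rotK φ i j = !![Real.cos φ, Real.sin φ; -Real.sin φ, Real.cos φ] i j := rfl

theorem SL_mul_apply (g h : SL(2, ℝ)) (i j : Fin 2) :
    (g * h) i j = g i 0 * h 0 j + g i 1 * h 1 j := by
  rw [Matrix.SpecialLinearGroup.coe_mul, Matrix.mul_apply, Fin.sum_univ_two]

theorem SL_inv_apply (g : SL(2, ℝ)) (i j : Fin 2) :
    g⁻¹ i j = !![g 1 1, -g 0 1; -g 1 0, g 0 0] i j := by
  rw [Matrix.SpecialLinearGroup.coe_inv, Matrix.adjugate_fin_two]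

theorem flow_upI (t : ℝ) : flow t upI = diagA t • upI := by
  have hc : Complex.cosh (t / 2) - Complex.sinh (t / 2) = Complex.exp (-(t / 2)) :=
    Complex.cosh_sub_sinh _
  have hs : Complex.cosh (t / 2) + Complex.sinh (t / 2) = Complex.exp (t / 2) :=
    Complex.cosh_add_sinh _
  have hD : flowDen t (dir upI) = (Real.exp (-(t / 2)) : ℝ) := by
    rw [flowDen, coe_dir_upI]
    push_cast
    linear_combination hc + Complex.sinh (t / 2) * Complex.I_sq
  have hd : den (diagA t) (base upI) = (Real.exp (-(t / 2)) : ℝ) := by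
    simp [den]
  refine UnitTangent.ext (UpperHalfPlane.ext ?_) ?_
  · rw [coe_base_flow, base_smul_SL, coe_smul, hd, hD]
    congr 1
    have hI : ((base upI : ℍ) : ℂ) = Complex.I := rfl
    simp only [flowNum, coe_dir_upI, hI, Complex.conj_I]
    simp only [diagA_apply, Matrix.of_apply, Matrix.cons_val', Matrix.cons_val_zero,
      Matrix.cons_val_one, Matrix.cons_val_fin_one]
    push_cast
    linear_combination Complex.I * hs - Complex.I * Complex.sinh (t / 2) * Complex.I_sq
  · rw [coe_dir_flow, dir_smul_SL, hd, hD]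

/-- Under the identification of the unit tangent bundle with `PSL(2, ℝ)`, the geodesic flow is the
right translation by diagonal matrices. -/
theorem flow_smul_upI (t : ℝ) (x : PSL(2, ℝ)) :
    flow t (x • upI) = (x * (diagA t : SL(2, ℝ))) • upI := by
  rw [flow_smul, flow_upI, mul_smul, mk_smul_tangent]

theorem rotK_smul_upI (φ : ℝ) :
    rotK φ • upI = vec UpperHalfPlane.I (Circle.exp (2 * φ) * dir upI) := by
  have hd : den (rotK φ) (base upI) = Complex.exp (-(φ * I)) := by
    rw [← neg_mul, Complex.exp_mul_I]
    simp [den]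
    ring
  refine UnitTangent.ext (UpperHalfPlane.ext ?_) ?_
  · rw [base_smul_SL, coe_smul, hd, div_eq_iff (Complex.exp_ne_zero _), ← neg_mul,
      Complex.exp_mul_I]
    simp
    linear_combination (Complex.sin φ) * Complex.I_sq
  · rw [dir_smul_SL, hd, ← Complex.exp_conj]
    simp only [dir_vec, Circle.coe_mul, Circle.coe_exp, coe_dir_upI]
    rw [← Complex.exp_sub, mul_comm]
    congr 2
    simp
    ring

instance : MulAction.IsPretransitive SL(2, ℝ) UnitTangent := by
  refine (MulAction.isPretransitive_iff_base upI).mpr fun v => ?_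
  obtain ⟨g, hg⟩ : ∃ g : SL(2, ℝ), base (g • upI) = base v :=
    ⟨(base v).toSL2R, UpperHalfPlane.toSL2R_smul_I _⟩
  obtain ⟨φ, hφ⟩ : ∃ φ : ℝ, (Circle.exp φ : ℂ) = dir (g⁻¹ • v) * (dir upI)⁻¹ := by
    obtain ⟨φ, hφ⟩ := Circle.exp_surjective (dir (g⁻¹ • v) * (dir upI)⁻¹)
    exact ⟨φ, by rw [hφ]; simp⟩
  refine ⟨g * rotK (φ / 2), ?_⟩
  rw [mul_smul, rotK_smul_upI, smul_eq_iff_eq_inv_smul]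
  refine UnitTangent.ext ?_ ?_
  · rw [base_smul_SL, ← hg, base_smul_SL, inv_smul_smul, base_vec, base_upI]
  · rw [dir_vec, Circle.coe_mul, mul_div_cancel₀ φ two_ne_zero, hφ, mul_assoc, ← Circle.coe_mul,
      inv_mul_cancel, Circle.coe_one, mul_one]

instance : MulAction.IsPretransitive PSL(2, ℝ) UnitTangent where
  exists_smul_eq v w := by
    obtain ⟨g, hg⟩ := MulAction.exists_smul_eq SL(2, ℝ) v w
    exact ⟨(g : PSL(2, ℝ)), hg⟩

theorem mk_eq_one_iff (g : SL(2, ℝ)) :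
    (g : PSL(2, ℝ)) = 1 ↔ g 0 1 = 0 ∧ g 1 0 = 0 ∧ g 0 0 = g 1 1 := by
  rw [QuotientGroup.eq_one_iff, Matrix.SpecialLinearGroup.mem_center_iff]
  constructor
  · rintro ⟨r, -, h⟩
    rw [← h]
    simp
  · rintro ⟨h₁, h₂, h₃⟩
    refine ⟨g 0 0, ?_, ?_⟩
    · have := g.det_coe
      rw [Matrix.det_fin_two, h₁, ← h₃] at this
      simpa [sq] using this
    · ext i j
      fin_cases i <;> fin_cases j <;> simp [h₁, h₂, h₃]

/-- The action on the unit tangent bundle is free. -/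
theorem eq_one_of_smul_eq {g : PSL(2, ℝ)} {v : UnitTangent} (h : g • v = v) : g = 1 := by
  obtain ⟨x, rfl⟩ := MulAction.exists_smul_eq PSL(2, ℝ) upI v
  have key : ∀ g : PSL(2, ℝ), g • upI = upI → g = 1 := by
    intro g h
    induction g using QuotientGroup.induction_on with
    | H g =>
      rw [mk_smul_tangent] at h
      have hI : ((base upI : ℍ) : ℂ) = Complex.I := rfl
      have hd := den_ne_zero g (base upI)
      have h₁ : (dir (g • upI) : ℂ) = dir upI := by rw [h]
      have h₂ : ((base (g • upI) : ℍ) : ℂ) = base upI := by rw [h]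
      rw [dir_smul_SL, coe_dir_upI, mul_eq_left₀ Complex.I_ne_zero, div_eq_one_iff_eq hd,
        Complex.conj_eq_iff_im] at h₁
      rw [base_smul_SL, coe_smul, div_eq_iff hd] at h₂
      have h10 : g 1 0 = 0 := by simpa [den, hI] using h₁
      rw [den, hI, h10] at h₂
      have h01 := congrArg Complex.re h₂
      have h00 := congrArg Complex.im h₂
      simp at h01 h00
      exact (mk_eq_one_iff g).mpr ⟨h01, h10, h00⟩
  have := key (x⁻¹ * g * x) (by rw [mul_smul, mul_smul, h, inv_smul_smul])
  rw [mul_assoc, inv_mul_eq_one] at this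
  exact right_eq_mul.mp this

theorem smul_left_injective (v : UnitTangent) :
    Function.Injective fun g : PSL(2, ℝ) => g • v := by
  intro g h hgh
  have : (h⁻¹ * g) • v = v := by rw [mul_smul, inv_smul_eq_iff]; exact hgh
  exact (inv_mul_eq_one.mp (eq_one_of_smul_eq this)).symm

/-- The orbit map of the reference vector identifies `PSL(2, ℝ)` with the unit tangent bundle. -/
def orbitHomeo : PSL(2, ℝ) ≃ₜ UnitTangent :=
  (Equiv.ofBijective (fun x : PSL(2, ℝ) => x • upI)
    ⟨smul_left_injective upI, MulAction.surjective_smul PSL(2, ℝ) upI⟩).toHomeomorphOfContinuousOpen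
    (continuous_id.smul continuous_const) (isOpenMap_smul_of_sigmaCompact upI)

theorem orbitHomeo_apply (x : PSL(2, ℝ)) : orbitHomeo x = x • upI := rfl

instance : T2Space PSL(2, ℝ) := orbitHomeo.isEmbedding.t2Space
instance : SecondCountableTopology PSL(2, ℝ) := orbitHomeo.secondCountableTopology
instance : LocallyCompactSpace PSL(2, ℝ) := orbitHomeo.isClosedEmbedding.locallyCompactSpace

/-! ### Invariance of the Liouville measure of the plane -/

instance : MeasurableSpace Circle := borel _
instance : BorelSpace Circle := ⟨rfl⟩

/-- The angular measure `dφ` on the circle. -/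
def angleMeasure : Measure Circle :=
  ((volume : Measure ℝ).restrict (Ioc (-Real.pi) Real.pi)).map Circle.exp

theorem measurable_circleExp : Measurable Circle.exp := Circle.exp.continuous.measurable

theorem angleMeasure_apply {A : Set Circle} (hA : MeasurableSet A) :
    angleMeasure A = volume (Circle.exp ⁻¹' A ∩ Ioc (-Real.pi) Real.pi) := by
  rw [angleMeasure, Measure.map_apply measurable_circleExp hA,
    Measure.restrict_apply (measurable_circleExp hA)]

theorem angleMeasure_univ : angleMeasure univ = ENNReal.ofReal (2 * Real.pi) := by
  rw [angleMeasure_apply MeasurableSet.univ]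
  rw [preimage_univ, univ_inter, Real.volume_Ioc]
  ring_nf

instance : IsFiniteMeasure angleMeasure := ⟨by rw [angleMeasure_univ]; exact ENNReal.ofReal_lt_top⟩

/-- The angular measure is rotation invariant, since it does not depend on the interval of length `2 π`
over which the angle ranges. -/
theorem angleMeasure_preimage_mul (c : Circle) {A : Set Circle} (hA : MeasurableSet A) :
    angleMeasure ((fun u => u * c) ⁻¹' A) = angleMeasure A := by
  obtain ⟨α, rfl⟩ := Circle.exp_surjective c
  have hm : Measurable fun u : Circle => u * Circle.exp α := (continuous_mul_const _).measurable
  have hT : (0 : ℝ) < 2 * Real.pi := by positivity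
  have h₁ := isAddFundamentalDomain_Ioc hT (-Real.pi) (volume : Measure ℝ)
  have h₂ := isAddFundamentalDomain_Ioc hT (-Real.pi + α) (volume : Measure ℝ)
  have hinv : ∀ g : AddSubgroup.zmultiples (2 * Real.pi),
      (fun x : ℝ => g +ᵥ x) ⁻¹' (Circle.exp ⁻¹' A) = Circle.exp ⁻¹' A := by
    rintro ⟨g, n, rfl⟩
    ext x
    have hx : Circle.exp (n • (2 * Real.pi) + x) = Circle.exp x := by
      rw [Circle.exp_add, zsmul_eq_mul]
      simp
    simp only [mem_preimage, AddSubgroup.vadd_def, vadd_eq_add, hx]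
  have h := h₁.measure_set_eq h₂ (measurable_circleExp hA) hinv
  rw [angleMeasure_apply (hm hA), angleMeasure_apply hA,
    show Ioc (-Real.pi) Real.pi = Ioc (-Real.pi) (-Real.pi + 2 * Real.pi) by congr 1; ring, h]
  · rw [← measure_preimage_add_right volume α (Circle.exp ⁻¹' A ∩ _)]
    congr 1
    ext x
    simp only [mem_preimage, mem_inter_iff, mem_Ioc, Circle.exp_add]
    refine and_congr_right fun _ => ⟨fun h => ⟨?_, ?_⟩, fun h => ⟨?_, ?_⟩⟩ <;> linarith [h.1, h.2]

theorem measurable_vec : Measurable fun q : ℍ × Circle => vec q.1 q.2 :=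
  tangentHomeo.symm.continuous.measurable

theorem liouvillePlane_apply {A : Set UnitTangent} (hA : MeasurableSet A) :
    liouvillePlane A = ∫⁻ z : ℍ, angleMeasure {u | vec z u ∈ A} := by
  have h : liouvillePlane =
      ((volume : Measure ℍ).prod angleMeasure).map fun q : ℍ × Circle => vec q.1 q.2 := by
    have h₁ : (volume : Measure ℍ).prod angleMeasure =
        ((volume : Measure ℍ).prod ((volume : Measure ℝ).restrict (Ioc (-Real.pi) Real.pi))).map
          (Prod.map id Circle.exp) := by
      rw [angleMeasure, ← Measure.map_prod_map _ _ measurable_id measurable_circleExp,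
        Measure.map_id]
    rw [h₁, Measure.map_map measurable_vec (measurable_id.prodMap measurable_circleExp)]
    rfl
  rw [h, Measure.map_apply measurable_vec hA, Measure.prod_apply (measurable_vec hA)]
  rfl

theorem measurable_angle_slice {A : Set UnitTangent} (hA : MeasurableSet A) :
    Measurable fun z : ℍ => angleMeasure {u | vec z u ∈ A} :=
  measurable_measure_prodMk_left (measurable_vec hA)

instance : SMulInvariantMeasure PSL(2, ℝ) ℍ volume where
  measure_preimage_smul g A hA := by
    induction g using QuotientGroup.induction_on with
    | H g => exact measure_preimage_smul_of_nullMeasurableSet (μ := (volume : Measure ℍ))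
              hA.nullMeasurableSet (Matrix.SpecialLinearGroup.mapGL ℝ g)

instance : SMulInvariantMeasure PSL(2, ℝ) UnitTangent liouvillePlane where
  measure_preimage_smul g A hA := by
    rw [liouvillePlane_apply hA,
      liouvillePlane_apply ((continuous_const_smul g).measurable hA)]
    have hmp : MeasurePreserving (fun z : ℍ => g • z) volume volume :=
      measurePreserving_smul g volume
    rw [← hmp.lintegral_comp (measurable_angle_slice hA)]
    congr 1
    ext z
    induction g using QuotientGroup.induction_on with
    | H g =>
      have hs : MeasurableSet {u | vec (g • z) u ∈ A} :=
        (measurable_vec.comp measurable_prodMk_left) hA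
      exact angleMeasure_preimage_mul (Circle.ofConjDivSelf (den g z) (den_ne_zero _ _)) hs

theorem liouvillePlane_base_preimage {A : Set ℍ} (hA : MeasurableSet A) :
    liouvillePlane (base ⁻¹' A) = ENNReal.ofReal (2 * Real.pi) * volume A := by
  rw [liouvillePlane_apply (continuous_base.measurable hA)]
  have : (fun z : ℍ => angleMeasure {u | vec z u ∈ base ⁻¹' A}) =
      A.indicator fun _ => ENNReal.ofReal (2 * Real.pi) := by
    ext z
    by_cases hz : z ∈ A
    · simp [hz, angleMeasure_univ]
    · simp [hz]
  rw [this, lintegral_indicator_const hA]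

theorem volume_pos_of_isOpen {U : Set ℍ} (hU : IsOpen U) (hne : U.Nonempty) :
    0 < (volume : Measure ℍ) U := by
  rw [UpperHalfPlane.volume_eq_lintegral]
  have hU' : IsOpen (((↑) : ℍ → ℂ) '' U) := UpperHalfPlane.isOpenEmbedding_coe.isOpenMap U hU
  refine setLIntegral_pos_iff (by fun_prop) |>.mpr ?_
  refine lt_of_lt_of_le (hU'.measure_pos volume (hne.image _)) (measure_mono ?_)
  rintro _ ⟨z, hz, rfl⟩
  refine ⟨?_, z, hz, rfl⟩
  simp [z.im_ne_zero]

/-! ### Unimodularity -/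

instance : MeasurableSpace PSL(2, ℝ) := borel _
instance : BorelSpace PSL(2, ℝ) := ⟨rfl⟩

/-- The Liouville measure of the plane, seen as a measure on `PSL(2, ℝ)`. -/
def haarPSL : Measure PSL(2, ℝ) := liouvillePlane.map orbitHomeo.symm

theorem haarPSL_apply (A : Set PSL(2, ℝ)) : haarPSL A = liouvillePlane (orbitHomeo.symm ⁻¹' A) :=
  orbitHomeo.symm.toMeasurableEquiv.map_apply A

theorem liouvillePlane_eq_haarPSL (A : Set UnitTangent) :
    liouvillePlane A = haarPSL (orbitHomeo ⁻¹' A) := by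
  rw [haarPSL_apply, ← preimage_comp, Homeomorph.self_comp_symm, preimage_id]

instance : haarPSL.IsMulLeftInvariant where
  map_mul_left_eq_self g := by
    ext A hA
    rw [Measure.map_apply (measurable_const_mul g) hA, haarPSL_apply, haarPSL_apply,
      ← measure_preimage_smul (μ := liouvillePlane) g (orbitHomeo.symm ⁻¹' A)]
    congr 1
    ext v
    obtain ⟨x, rfl⟩ := orbitHomeo.surjective v
    have : g • orbitHomeo x = orbitHomeo (g * x) := by
      simp only [orbitHomeo_apply, mul_smul]
    simp only [mem_preimage, this, Homeomorph.symm_apply_apply]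

instance : haarPSL.IsHaarMeasure := by
  set K : Set ℍ := Metric.closedBall UpperHalfPlane.I 1
  have hK : IsCompact K := isCompact_closedBall _ _
  have hKi : (interior K).Nonempty :=
    ⟨UpperHalfPlane.I, Metric.ball_subset_interior_closedBall (Metric.mem_ball_self one_pos)⟩
  have hK' : IsCompact (base ⁻¹' K) := by
    have : base ⁻¹' K = tangentHomeo ⁻¹' (K ×ˢ univ) := by
      ext v
      exact ⟨fun h => ⟨h, mem_univ _⟩, fun h => h.1⟩
    rw [this, ← Homeomorph.image_symm]
    exact (hK.prod isCompact_univ).image tangentHomeo.symm.continuous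
  have hval : haarPSL (orbitHomeo ⁻¹' (base ⁻¹' K)) = ENNReal.ofReal (2 * Real.pi) * volume K := by
    rw [← liouvillePlane_eq_haarPSL, liouvillePlane_base_preimage hK.measurableSet]
  refine Measure.isHaarMeasure_of_isCompact_nonempty_interior _ (orbitHomeo ⁻¹' (base ⁻¹' K))
    ?_ ?_ ?_ ?_
  · rw [← Homeomorph.image_symm]
    exact hK'.image orbitHomeo.symm.continuous
  · obtain ⟨z, hz⟩ := hKi
    obtain ⟨x, hx⟩ := orbitHomeo.surjective (vec z 1)
    refine ⟨x, ?_⟩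
    refine interior_maximal (preimage_mono (preimage_mono interior_subset))
      ((isOpen_interior.preimage continuous_base).preimage orbitHomeo.continuous) ?_
    simpa [hx] using hz
  · rw [hval]
    refine mul_ne_zero (by simp [Real.pi_pos]) ?_
    exact ((volume_pos_of_isOpen isOpen_interior hKi).trans_le
      (measure_mono interior_subset)).ne'
  · rw [hval]
    exact ENNReal.mul_ne_top ENNReal.ofReal_ne_top hK.measure_lt_top.ne

theorem upper_add (s t : ℝ) : upper (s + t) = upper s * upper t := by
  ext i j
  fin_cases i <;> fin_cases j <;> simp [SL_mul_apply, add_comm]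

theorem lower_add (s t : ℝ) : lower (s + t) = lower s * lower t := by
  ext i j
  fin_cases i <;> fin_cases j <;> simp [SL_mul_apply]

theorem diagA_add (s t : ℝ) : diagA (s + t) = diagA s * diagA t := by
  ext i j
  fin_cases i <;> fin_cases j <;> simp [SL_mul_apply, ← Real.exp_add] <;> ring_nf

theorem diagA_zero : diagA 0 = 1 := by
  ext i j
  fin_cases i <;> fin_cases j <;> simp

theorem diagA_mul_upper (t s : ℝ) : diagA t * upper s = upper (Real.exp t * s) * diagA t := by
  have h : Real.exp t = Real.exp (t / 2) * Real.exp (t / 2) := by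
    rw [← Real.exp_add, add_halves]
  have h' : Real.exp (t / 2) * Real.exp (-(t / 2)) = 1 := by simp [← Real.exp_add]
  ext i j
  fin_cases i <;> fin_cases j <;> simp [SL_mul_apply]
  rw [h]
  linear_combination (-s * Real.exp (t / 2)) * h'

theorem diagA_mul_lower (t s : ℝ) : diagA t * lower s = lower (Real.exp (-t) * s) * diagA t := by
  have h : Real.exp (-t) = Real.exp (-(t / 2)) * Real.exp (-(t / 2)) := by
    rw [← Real.exp_add]; ring_nf
  have h' : Real.exp (t / 2) * Real.exp (-(t / 2)) = 1 := by simp [← Real.exp_add]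
  ext i j
  fin_cases i <;> fin_cases j <;> simp [SL_mul_apply]
  rw [h]
  linear_combination (-s * Real.exp (-(t / 2))) * h'

/-- The unipotent matrices generate. -/
theorem submonoid_eq_top {M : Submonoid PSL(2, ℝ)} (hu : ∀ s, ((upper s : SL(2, ℝ)) : PSL(2, ℝ)) ∈ M)
    (hl : ∀ s, ((lower s : SL(2, ℝ)) : PSL(2, ℝ)) ∈ M) (p : PSL(2, ℝ)) : p ∈ M := by
  -- A matrix with nonzero lower left entry is a product of three unipotent matrices.
  have key : ∀ g : SL(2, ℝ), g 1 0 ≠ 0 → (g : PSL(2, ℝ)) ∈ M := by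
    intro g hc
    have hdet := g.det_coe
    rw [Matrix.det_fin_two] at hdet
    have : g = upper ((g 0 0 - 1) / g 1 0) * lower (g 1 0) * upper ((g 1 1 - 1) / g 1 0) := by
      ext i j
      fin_cases i <;> fin_cases j <;> simp [SL_mul_apply] <;> field_simp
      · ring
      · linear_combination -hdet
      · ring
    rw [this, QuotientGroup.mk_mul, QuotientGroup.mk_mul]
    exact M.mul_mem (M.mul_mem (hu _) (hl _)) (hu _)
  induction p using QuotientGroup.induction_on with
  | H g =>
    by_cases hc : g 1 0 = 0
    · have hdet := g.det_coe
      rw [Matrix.det_fin_two, hc] at hdet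
      have hd : g 1 1 ≠ 0 := by
        rintro h
        simp [h] at hdet
      have h1 : g = (g * lower 1) * lower (-1) := by
        rw [mul_assoc, ← lower_add]
        have : lower (1 + -1) = 1 := by
          ext i j
          fin_cases i <;> fin_cases j <;> simp
        rw [this, mul_one]
      rw [h1, QuotientGroup.mk_mul]
      refine M.mul_mem (key _ ?_) (hl _)
      simpa [SL_mul_apply, hc] using hd
    · exact key g hc

/-- `PSL(2, ℝ)` has no nontrivial positive characters: conjugation by diagonal matrices makes
every unipotent matrix conjugate to its square. -/
theorem modularCharacter_eq_one (p : PSL(2, ℝ)) : Measure.modularCharacter p = 1 := by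
  set χ : PSL(2, ℝ) →* NNReal := Measure.modularCharacter
  have hpos : ∀ x, χ x ≠ 0 := fun x => (Measure.modularCharacterFun_pos x).ne'
  have key : ∀ a u : SL(2, ℝ), a * u = (u * u) * a → χ u = 1 := by
    intro a u h
    have h' := congrArg (fun g : SL(2, ℝ) => χ (g : PSL(2, ℝ))) h
    simp only [QuotientGroup.mk_mul, map_mul] at h'
    have h1 := hpos (a : PSL(2, ℝ))
    have h2 := hpos (u : PSL(2, ℝ))
    rw [mul_comm] at h'
    have h3 := mul_right_cancel₀ h1 h'
    exact (right_eq_mul₀ h2).mp h3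
  refine submonoid_eq_top (M := χ.ker.toSubmonoid) (fun s => ?_) (fun s => ?_) p
  · refine key (diagA (Real.log 2)) _ ?_
    rw [diagA_mul_upper, Real.exp_log two_pos, two_mul, upper_add]
  · refine key (diagA (-Real.log 2)) _ ?_
    rw [diagA_mul_lower, neg_neg, Real.exp_log two_pos, two_mul, lower_add]

instance : haarPSL.IsMulRightInvariant where
  map_mul_right_eq_self p := by
    rw [Measure.map_right_mul_eq_modularCharacterFun_smul]
    have : Measure.modularCharacterFun p = 1 := modularCharacter_eq_one p
    rw [this, one_smul]

theorem continuous_flow (t : ℝ) : Continuous (flow t) := by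
  have : flow t = fun v => orbitHomeo (orbitHomeo.symm v * (diagA t : SL(2, ℝ))) := by
    ext v
    obtain ⟨x, rfl⟩ := orbitHomeo.surjective v
    rw [Homeomorph.symm_apply_apply, orbitHomeo_apply, orbitHomeo_apply, flow_smul_upI]
  rw [this]
  exact orbitHomeo.continuous.comp (orbitHomeo.symm.continuous.mul continuous_const)

/-- Liouville's theorem: the geodesic flow preserves the Liouville measure. -/
theorem measurePreserving_flow (t : ℝ) :
    MeasurePreserving (flow t) liouvillePlane liouvillePlane := by
  refine ⟨(continuous_flow t).measurable, ?_⟩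
  ext A hA
  rw [Measure.map_apply (continuous_flow t).measurable hA, liouvillePlane_eq_haarPSL,
    liouvillePlane_eq_haarPSL,
    ← measure_preimage_mul_right haarPSL (diagA t : SL(2, ℝ)) (orbitHomeo ⁻¹' A)]
  congr 1
  ext x
  simp only [mem_preimage, orbitHomeo_apply, flow_smul_upI]

/-- The geodesic flow for time `t` as a homeomorphism. -/
def flowHomeo (t : ℝ) : UnitTangent ≃ₜ UnitTangent where
  toFun := flow t
  invFun := flow (-t)
  left_inv v := by rw [← flow_add, neg_add_cancel, flow_zero]
  right_inv v := by rw [← flow_add, add_neg_cancel, flow_zero]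
  continuous_toFun := continuous_flow t
  continuous_invFun := continuous_flow (-t)

/-! ### Fundamental domains of discrete groups of finite coarea -/

theorem countable_of_discrete (G : Subgroup PSL(2, ℝ)) [DiscreteTopology G] : Countable G :=
  TopologicalSpace.separableSpace_iff_countable.mp inferInstance

/-- A discrete subgroup of `PSL(2, ℝ)` acts properly discontinuously, since the unit tangent
vectors with base point in a compact set form a compact subset of `PSL(2, ℝ)`. -/
instance (G : Subgroup PSL(2, ℝ)) [DiscreteTopology G] : ProperlyDiscontinuousSMul G ℍ where
  finite_disjoint_inter_image {K L} hK hL := by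
    have hcomp : ∀ K : Set ℍ, IsCompact K → IsCompact (orbitHomeo ⁻¹' (base ⁻¹' K)) := by
      intro K hK
      have : base ⁻¹' K = tangentHomeo ⁻¹' (K ×ˢ univ) := by
        ext v
        exact ⟨fun h => ⟨h, mem_univ _⟩, fun h => h.1⟩
      rw [this, ← Homeomorph.image_symm, ← Homeomorph.image_symm]
      exact ((hK.prod isCompact_univ).image tangentHomeo.symm.continuous).image
        orbitHomeo.symm.continuous
    have hC := (hcomp L hL).mul (hcomp K hK).inv
    have hGc : IsClosed (G : Set PSL(2, ℝ)) := Subgroup.isClosed_of_discrete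
    have hC' : IsCompact ((↑) ⁻¹' (orbitHomeo ⁻¹' (base ⁻¹' L) * (orbitHomeo ⁻¹' (base ⁻¹' K))⁻¹) :
        Set G) := hGc.isClosedEmbedding_subtypeVal.isCompact_preimage hC
    refine (hC'.finite_of_discrete).subset ?_
    rintro g ⟨_, ⟨z, hz, rfl⟩, hgz⟩
    obtain ⟨x, hx⟩ := orbitHomeo.surjective (vec z 1)
    refine mem_mul.mpr ⟨g * x, ?_, x⁻¹, ?_, by simp⟩
    · have : base (orbitHomeo (g * x)) = g • z := by
        rw [orbitHomeo_apply, mul_smul, base_smul, ← orbitHomeo_apply, hx, base_vec]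
        rfl
      rw [mem_preimage, mem_preimage, this]
      exact hgz
    · simpa [hx] using hz

theorem eq_of_smul_eq_self {g : PSL(2, ℝ)} (hg : g ≠ 1) {z w : ℍ} (hz : g • z = z)
    (hw : g • w = w) : z = w := by
  induction g using QuotientGroup.induction_on with
  | H g =>
    rw [mk_smul] at hz hw
    have fix : ∀ z : ℍ, g • z = z →
        (g 0 0 : ℂ) * z + (g 0 1 : ℂ) = z * ((g 1 0 : ℂ) * z + (g 1 1 : ℂ)) := by
      intro z hz
      have h := coe_smul g z
      rw [hz, eq_div_iff (den_ne_zero g z)] at h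
      exact h.symm
    have h₁ := fix z hz
    have h₂ := fix w hw
    by_contra hne
    have hne' : (z : ℂ) - w ≠ 0 := sub_ne_zero.mpr fun h => hne (UpperHalfPlane.ext h)
    have h₃ : (g 1 0 : ℂ) * (z + w) + ((g 1 1 : ℂ) - g 0 0) = 0 := by
      refine mul_left_cancel₀ hne' ?_
      linear_combination h₂ - h₁
    have him := congrArg Complex.im h₃
    simp only [Complex.add_im, Complex.mul_im, Complex.ofReal_re, Complex.ofReal_im, zero_mul,
      add_zero, Complex.sub_im, sub_self, Complex.zero_im, UpperHalfPlane.coe_im,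
      mul_eq_zero] at him
    have h10 : g 1 0 = 0 := him.resolve_right (add_pos z.im_pos w.im_pos).ne'
    have hd : g 1 1 - g 0 0 = 0 := by
      rw [h10] at h₃
      simpa [← Complex.ofReal_sub] using h₃
    have hd' := sub_eq_zero.mp hd
    rw [h10, hd', Complex.ofReal_zero] at h₁
    refine hg ((mk_eq_one_iff g).mpr ⟨?_, h10, hd'.symm⟩)
    have : (g 0 1 : ℂ) = 0 := by linear_combination h₁
    exact_mod_cast this

instance : NullSingletonClass (volume : Measure ℍ) where
  measure_singleton z := by
    rw [UpperHalfPlane.volume_eq_lintegral, image_singleton]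
    simp

/-- The points with nontrivial stabilizer form a null set. -/
theorem ae_stabilizer_trivial (G : Subgroup PSL(2, ℝ)) [DiscreteTopology G] :
    ∀ᵐ z : ℍ, ∀ g : G, g • z = z → g = 1 := by
  have := countable_of_discrete G
  refine ae_all_iff.mpr fun g => ?_
  by_cases hg : g = 1
  · exact Filter.Eventually.of_forall fun _ _ => hg
  · have hs : {z : ℍ | g • z = z}.Subsingleton := fun z hz w hw =>
      eq_of_smul_eq_self (g := (g : PSL(2, ℝ))) (fun h => hg (Subtype.ext h)) hz hw
    filter_upwards [measure_eq_zero_iff_ae_notMem.mp (hs.measure_zero volume)] with z hz h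
    exact absurd h hz

/-- A discrete group has a Borel set in the hyperbolic plane that maps injectively to the quotient
and meets almost every orbit. -/
theorem exists_domain (G : Subgroup PSL(2, ℝ)) [DiscreteTopology G] :
    ∃ F : Set ℍ, MeasurableSet F ∧ (∀ g : G, g ≠ 1 → ∀ z ∈ F, g • z ∉ F) ∧
      ∀ᵐ z : ℍ, ∃ g : G, g • z ∈ F := by
  have := countable_of_discrete G
  set B : Set (Set ℍ) := {b ∈ TopologicalSpace.countableBasis ℍ |
    ∀ g : G, g ≠ 1 → ∀ z ∈ b, g • z ∉ b} with hB
  have hBc : (insert ∅ B).Countable :=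
    ((TopologicalSpace.countable_countableBasis ℍ).mono (sep_subset _ _)).insert _
  obtain ⟨U, hU⟩ := hBc.exists_eq_range (insert_nonempty _ _)
  have hU' : ∀ n, IsOpen (U n) ∧ ∀ g : G, g ≠ 1 → ∀ z ∈ U n, g • z ∉ U n := by
    intro n
    rcases (hU ▸ mem_range_self n : U n ∈ insert ∅ B) with h | h
    · simp [h]
    · exact ⟨TopologicalSpace.isOpen_of_mem_countableBasis h.1, h.2⟩
  have hcover : ∀ z : ℍ, (∀ g : G, g • z = z → g = 1) → ∃ n, z ∈ U n := by
    intro z hz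
    obtain ⟨V, hV, hVg⟩ := ProperlyDiscontinuousSMul.exists_nhds_image_smul_eq_self G z
    obtain ⟨b, hb, hzb, hbV⟩ := (TopologicalSpace.isBasis_countableBasis ℍ).mem_nhds_iff.mp hV
    have : b ∈ range U := by
      rw [← hU]
      refine Or.inr ⟨hb, fun g hg w hw hgw => hg (hz g (hVg g ⟨g • w, ⟨w, hbV hw, rfl⟩, hbV hgw⟩))⟩
    obtain ⟨n, rfl⟩ := this
    exact ⟨n, hzb⟩
  -- From each basis set, keep the points whose orbits avoid all earlier basis sets.
  refine ⟨⋃ n, U n \ ⋃ k < n, ⋃ g : G, (fun z => g • z) ⁻¹' U k, ?_, ?_, ?_⟩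
  · refine MeasurableSet.iUnion fun n => (hU' n).1.measurableSet.diff ?_
    refine MeasurableSet.iUnion fun k => MeasurableSet.iUnion fun _ => MeasurableSet.iUnion fun g =>
      (continuous_const_smul g).measurable (hU' k).1.measurableSet
  · intro g hg z hz hgz
    simp only [mem_iUnion, mem_sdiff, mem_preimage, not_exists] at hz hgz
    obtain ⟨n, hn, hn'⟩ := hz
    obtain ⟨m, hm, hm'⟩ := hgz
    rcases lt_trichotomy m n with h | rfl | h
    · exact hn' m h g hm
    · exact (hU' m).2 g hg z hn hm
    · exact hm' n h g⁻¹ (by rwa [inv_smul_smul])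
  · filter_upwards [ae_stabilizer_trivial G] with z hz
    have hex : ∃ n, ∃ g : G, g • z ∈ U n := by
      obtain ⟨n, hn⟩ := hcover z hz
      exact ⟨n, 1, by simpa using hn⟩
    classical
    obtain ⟨g, hg⟩ := Nat.find_spec hex
    refine ⟨g, mem_iUnion.mpr ⟨Nat.find hex, hg, ?_⟩⟩
    simp only [mem_iUnion, mem_preimage, not_exists]
    intro k hk h hh
    exact Nat.find_min hex hk ⟨h * g, by rwa [mul_smul]⟩

theorem injOn_mk_of_forall_smul_notMem {G : Subgroup PSL(2, ℝ)} {F : Set ℍ}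
    (hF : ∀ g : G, g ≠ 1 → ∀ z ∈ F, g • z ∉ F) :
    InjOn (Quotient.mk (MulAction.orbitRel G ℍ)) F := by
  intro z hz w hw h
  obtain ⟨g, hg⟩ := Quotient.exact h
  have hg' : g • w = z := hg
  by_cases hg1 : g = 1
  · rw [← hg', hg1, one_smul]
  · exact absurd (hg' ▸ hz) (hF g hg1 w hw)

/-- A discrete group of finite coarea has a fundamental domain of finite Liouville measure in the
unit tangent bundle. -/
theorem exists_fundamentalDomain (G : Subgroup PSL(2, ℝ)) [DiscreteTopology G] (hG : area G ≠ ⊤) :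
    ∃ F : Set UnitTangent, IsFundamentalDomain G F liouvillePlane ∧ liouvillePlane F ≠ ⊤ := by
  have := countable_of_discrete G
  obtain ⟨F, hFm, hF, hFae⟩ := exists_domain G
  have hvol : volume F ≤ area G := by
    rw [← quotientMeasure_image (G := G) volume hFm (injOn_mk_of_forall_smul_notMem hF)]
    exact measure_mono (subset_univ _)
  refine ⟨base ⁻¹' F, IsFundamentalDomain.mk'' ?_ ?_ ?_ ?_, ?_⟩
  · exact (continuous_base.measurable hFm).nullMeasurableSet
  · obtain ⟨N, hN, hNm, hN0⟩ := exists_measurable_superset_of_null (ae_iff.mp hFae)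
    refine ae_iff.mpr (measure_mono_null (t := base ⁻¹' N) ?_ ?_)
    · intro v hv
      refine hN fun ⟨g, hg⟩ => hv ⟨g, ?_⟩
      have : base (g • v) = g • base v := base_smul g v
      rwa [mem_preimage, this]
    · rw [liouvillePlane_base_preimage hNm, hN0, mul_zero]
  · intro g hg
    refine Disjoint.aedisjoint (disjoint_left.mpr ?_)
    rintro _ ⟨v, hv, rfl⟩ hgv
    have : base (g • v) = g • base v := base_smul g v
    rw [mem_preimage] at hgv
    exact hF g hg (base v) hv (this ▸ hgv)
  · exact fun g => (measurePreserving_smul g liouvillePlane).quasiMeasurePreserving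
  · rw [liouvillePlane_base_preimage hFm]
    exact ENNReal.mul_ne_top ENNReal.ofReal_ne_top (ne_top_of_le_ne_top hG hvol)

/-! ### Recurrence of the geodesic flow -/

theorem continuous_tangentProj (G : Subgroup PSL(2, ℝ)) : Continuous (tangentProj G) :=
  continuous_quotient_mk'

theorem isOpenMap_tangentProj (G : Subgroup PSL(2, ℝ)) : IsOpenMap (tangentProj G) :=
  isOpenMap_quotient_mk'_mul

theorem tangentProj_surjective (G : Subgroup PSL(2, ℝ)) : Function.Surjective (tangentProj G) :=
  Quotient.mk_surjective

theorem measurable_tangentProj (G : Subgroup PSL(2, ℝ)) : Measurable (tangentProj G) :=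
  @measurable_quotient_mk' UnitTangent _ (MulAction.orbitRel G UnitTangent)

theorem tangentProj_eq_iff {G : Subgroup PSL(2, ℝ)} {v w : UnitTangent} :
    tangentProj G v = tangentProj G w ↔ ∃ g ∈ G, g • w = v := by
  constructor
  · intro h
    obtain ⟨g, hg⟩ := Quotient.exact h
    exact ⟨g, g.2, hg⟩
  · rintro ⟨g, hg, h⟩
    exact Quotient.sound ⟨⟨g, hg⟩, h⟩

theorem tangentProj_smul {G : Subgroup PSL(2, ℝ)} {g : PSL(2, ℝ)} (hg : g ∈ G) (v : UnitTangent) :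
    tangentProj G (g • v) = tangentProj G v :=
  tangentProj_eq_iff.mpr ⟨g, hg, rfl⟩

theorem surfaceFlow_tangentProj (G : Subgroup PSL(2, ℝ)) (t : ℝ) (v : UnitTangent) :
    surfaceFlow G t (tangentProj G v) = tangentProj G (flow t v) := rfl

instance (G : Subgroup PSL(2, ℝ)) : OpensMeasurableSpace (SurfaceTangent G) where
  borel_le := by
    refine MeasurableSpace.generateFrom_le fun U hU => ?_
    exact ((IsOpen.preimage (continuous_tangentProj G) hU).measurableSet :
      MeasurableSet (tangentProj G ⁻¹' U))

instance (G : Subgroup PSL(2, ℝ)) : SecondCountableTopology (SurfaceTangent G) :=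
  ContinuousConstSMul.secondCountableTopology

theorem measurable_surfaceFlow (G : Subgroup PSL(2, ℝ)) (t : ℝ) : Measurable (surfaceFlow G t) := by
  intro A hA
  have h : MeasurableSet (flow t ⁻¹' (tangentProj G ⁻¹' A)) :=
    (continuous_flow t).measurable (measurable_tangentProj G hA)
  exact h

/-- The measure that a fundamental domain induces on the quotient is invariant under the geodesic
flow, because the flow commutes with the group. -/
theorem measurePreserving_surfaceFlow {G : Subgroup PSL(2, ℝ)} [DiscreteTopology G]
    {F : Set UnitTangent} (hF : IsFundamentalDomain G F liouvillePlane) (t : ℝ) :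
    MeasurePreserving (surfaceFlow G t) ((liouvillePlane.restrict F).map (tangentProj G))
      ((liouvillePlane.restrict F).map (tangentProj G)) := by
  have := countable_of_discrete G
  refine ⟨measurable_surfaceFlow G t, ?_⟩
  have hF' : IsFundamentalDomain G (flowHomeo t '' F) liouvillePlane := by
    refine hF.image_of_equiv (flowHomeo t).toEquiv ?_ (Equiv.refl _) ?_
    · exact (measurePreserving_flow (-t)).quasiMeasurePreserving
    · exact fun g v => flow_smul t g v
  ext A hA
  have hπ := measurable_tangentProj G
  have hB := hπ hA
  have hm := (continuous_flow t).measurable hB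
  rw [Measure.map_apply (measurable_surfaceFlow G t) hA,
    Measure.map_apply hπ (measurable_surfaceFlow G t hA), Measure.map_apply hπ hA,
    Measure.restrict_apply (hπ (measurable_surfaceFlow G t hA)), Measure.restrict_apply hB]
  have h₁ : tangentProj G ⁻¹' (surfaceFlow G t ⁻¹' A) ∩ F =
      flow t ⁻¹' (tangentProj G ⁻¹' A ∩ flowHomeo t '' F) := by
    ext v
    simp only [mem_inter_iff, mem_preimage, surfaceFlow_tangentProj]
    exact and_congr_right fun _ => ((flowHomeo t).injective.mem_set_image).symm
  rw [h₁, (measurePreserving_flow t).measure_preimage (hB.nullMeasurableSet.inter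
    hF'.nullMeasurableSet)]
  refine hF'.measure_set_eq hF hB fun g => ?_
  ext v
  exact iff_of_eq (congrArg (· ∈ A) (tangentProj_smul g.2 v))

theorem iterate_surfaceFlow (G : Subgroup PSL(2, ℝ)) (t : ℝ) (n : ℕ) (v : UnitTangent) :
    (surfaceFlow G t)^[n] (tangentProj G v) = tangentProj G (flow (n * t) v) := by
  induction n with
  | zero => simp [flow_zero]
  | succ n ih =>
    rw [Function.iterate_succ_apply', ih, surfaceFlow_tangentProj, ← flow_add]
    congr 2
    push_cast
    ring

/-- The elements of `PSL(2, ℝ)` that return to each of their neighborhoods infinitely often,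
modulo the group `G`, under right translation by powers of `a`. -/
def recurrentSet (G : Subgroup PSL(2, ℝ)) (a : PSL(2, ℝ)) : Set PSL(2, ℝ) :=
  {x | ∀ N ∈ 𝓝 x, ∃ᶠ n : ℕ in Filter.atTop, ∃ g ∈ G, g * (x * a ^ n) ∈ N}

theorem coe_diagA_mul_nat (t : ℝ) (n : ℕ) :
    ((diagA (n * t) : SL(2, ℝ)) : PSL(2, ℝ)) = ((diagA t : SL(2, ℝ)) : PSL(2, ℝ)) ^ n := by
  induction n with
  | zero => simp [diagA_zero]
  | succ n ih =>
    rw [pow_succ, ← ih, ← QuotientGroup.mk_mul, ← diagA_add]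
    congr 2
    push_cast
    ring

/-- Poincaré recurrence. -/
theorem ae_mem_recurrentSet {G : Subgroup PSL(2, ℝ)} [DiscreteTopology G] (hG : area G ≠ ⊤)
    (t : ℝ) : ∀ᵐ x ∂haarPSL, x ∈ recurrentSet G (diagA t : SL(2, ℝ)) := by
  have := countable_of_discrete G
  obtain ⟨F, hF, hFfin⟩ := exists_fundamentalDomain G hG
  have hπ := measurable_tangentProj G
  have hfin : IsFiniteMeasure ((liouvillePlane.restrict F).map (tangentProj G)) := by
    refine ⟨?_⟩
    rw [Measure.map_apply hπ MeasurableSet.univ, preimage_univ, Measure.restrict_apply_univ]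
    exact hFfin.lt_top
  have hcons := (measurePreserving_surfaceFlow hF t).conservative
  have h := ae_of_ae_map hπ.aemeasurable hcons.ae_frequently_mem_of_mem_nhds
  set R : Set UnitTangent := {v | ∀ s ∈ 𝓝 (tangentProj G v),
    ∃ᶠ n : ℕ in Filter.atTop, (surfaceFlow G t)^[n] (tangentProj G v) ∈ s} with hR
  have hRinv : ∀ g : G, ∀ v, g • v ∈ R ↔ v ∈ R := by
    intro g v
    have : tangentProj G (g • v) = tangentProj G v := tangentProj_smul g.2 v
    simp only [hR, mem_ofPred_eq, this]
  have hRnull : liouvillePlane Rᶜ = 0 := by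
    refine hF.measure_zero_of_invariant _ (fun g => ?_) ?_
    · ext v
      rw [mem_smul_set_iff_inv_smul_mem, mem_compl_iff, mem_compl_iff, hRinv]
    · have h0 : (liouvillePlane.restrict F) Rᶜ = 0 := ae_iff.mp h
      rwa [Measure.restrict_apply₀' hF.nullMeasurableSet] at h0
  refine ae_iff.mpr (measure_mono_null (t := orbitHomeo ⁻¹' Rᶜ) ?_ ?_)
  · intro x hx hxR
    refine hx fun N hN => ?_
    have hN' : tangentProj G '' (orbitHomeo '' N) ∈ 𝓝 (tangentProj G (orbitHomeo x)) :=
      (isOpenMap_tangentProj G).image_mem_nhds (orbitHomeo.isOpenMap.image_mem_nhds hN)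
    refine (hxR _ hN').mono ?_
    rintro n ⟨_, ⟨y, hy, rfl⟩, hyn⟩
    rw [iterate_surfaceFlow, orbitHomeo_apply, orbitHomeo_apply, flow_smul_upI,
      tangentProj_eq_iff] at hyn
    obtain ⟨g, hg, h⟩ := hyn
    refine ⟨g, hg, ?_⟩
    rw [← mul_smul] at h
    rw [← coe_diagA_mul_nat, smul_left_injective upI h]
    exact hy
  · rw [← liouvillePlane_eq_haarPSL, hRnull]

/-! ### Dense orbits -/

/-- The Hopf argument along a horocycle: if `u` is contracted by conjugation with the powers of `a`,
then a recurrent point `x * u` lies in every closed set that is invariant under `G` and contains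
the forward orbit of `x`. -/
theorem mul_mem_of_recurrent {G : Subgroup PSL(2, ℝ)} {K : Set PSL(2, ℝ)} (hK : IsClosed K)
    (hKG : ∀ g ∈ G, ∀ x ∈ K, g * x ∈ K) {a u : PSL(2, ℝ)}
    (hu : Filter.Tendsto (fun n : ℕ => (a ^ n)⁻¹ * u * a ^ n) Filter.atTop (𝓝 1))
    {x : PSL(2, ℝ)} (hx : ∀ n : ℕ, x * a ^ n ∈ K) (hxu : x * u ∈ recurrentSet G a) :
    x * u ∈ K := by
  rw [← hK.closure_eq, mem_closure_iff_nhds]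
  intro N hN
  have hc : Filter.Tendsto (fun q : PSL(2, ℝ) × PSL(2, ℝ) => q.1 * q.2⁻¹) (𝓝 (x * u, 1))
      (𝓝 (x * u)) := by
    have : ContinuousAt (fun q : PSL(2, ℝ) × PSL(2, ℝ) => q.1 * q.2⁻¹) (x * u, 1) :=
      (continuous_fst.mul continuous_snd.inv).continuousAt
    simpa [ContinuousAt] using this
  have hN' := hc hN
  rw [nhds_prod_eq, Filter.mem_map, Filter.mem_prod_iff] at hN'
  obtain ⟨N₁, hN₁, N₂, hN₂, hsub⟩ := hN'
  obtain ⟨n, ⟨g, hg, hgn⟩, hn⟩ := ((hxu N₁ hN₁).and_eventually (hu hN₂)).exists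
  refine ⟨g * (x * a ^ n), ?_, hKG g hg _ (hx n)⟩
  have h := hsub (mk_mem_prod hgn hn)
  have e : g * (x * u * a ^ n) * ((a ^ n)⁻¹ * u * a ^ n)⁻¹ = g * (x * a ^ n) := by group
  rw [mem_preimage, e] at h
  exact h

/-- A recurrent point of a closed forward invariant set has its whole orbit in the set. -/
theorem mul_pow_inv_mem_of_recurrent {G : Subgroup PSL(2, ℝ)} {K : Set PSL(2, ℝ)}
    (hK : IsClosed K) (hKG : ∀ g ∈ G, ∀ x ∈ K, g * x ∈ K) {a : PSL(2, ℝ)}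
    (hKa : ∀ x ∈ K, x * a ∈ K) {x : PSL(2, ℝ)} (hx : x ∈ K)
    (k : ℕ) (hxr : x * (a ^ k)⁻¹ ∈ recurrentSet G a) : x * (a ^ k)⁻¹ ∈ K := by
  have hpow : ∀ n : ℕ, ∀ y ∈ K, y * a ^ n ∈ K := by
    intro n
    induction n with
    | zero => intro y hy; simpa using hy
    | succ n ih => intro y hy; rw [pow_succ, ← mul_assoc]; exact hKa _ (ih y hy)
  rw [← hK.closure_eq, mem_closure_iff_nhds]
  intro N hN
  obtain ⟨n, ⟨g, hg, hgn⟩, hn⟩ :=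
    ((hxr N hN).and_eventually (Filter.eventually_ge_atTop k)).exists
  obtain ⟨m, rfl⟩ := Nat.exists_eq_add_of_le hn
  refine ⟨_, hgn, hKG g hg _ ?_⟩
  rw [pow_add, ← mul_assoc, inv_mul_cancel_right]
  exact hpow m x hx

theorem continuous_upper : Continuous fun s : ℝ => ((upper s : SL(2, ℝ)) : PSL(2, ℝ)) := by
  refine QuotientGroup.continuous_mk.comp (Continuous.subtype_mk ?_ _)
  exact continuous_matrix (by intro i j; fin_cases i <;> fin_cases j <;> simp <;> fun_prop)

theorem continuous_lower : Continuous fun s : ℝ => ((lower s : SL(2, ℝ)) : PSL(2, ℝ)) := by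
  refine QuotientGroup.continuous_mk.comp (Continuous.subtype_mk ?_ _)
  exact continuous_matrix (by intro i j; fin_cases i <;> fin_cases j <;> simp <;> fun_prop)

theorem tendsto_exp_neg_nat_mul {t : ℝ} (ht : 0 < t) (s : ℝ) :
    Filter.Tendsto (fun n : ℕ => Real.exp (-(n * t)) * s) Filter.atTop (𝓝 0) := by
  have := (Real.tendsto_exp_neg_atTop_nhds_zero.comp
    ((tendsto_natCast_atTop_atTop (R := ℝ)).atTop_mul_const ht)).mul_const s
  simpa using this

theorem tendsto_conj_upper {t : ℝ} (ht : 0 < t) (s : ℝ) :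
    Filter.Tendsto (fun n : ℕ => (((diagA t : SL(2, ℝ)) : PSL(2, ℝ)) ^ n)⁻¹ *
      ((upper s : SL(2, ℝ)) : PSL(2, ℝ)) * ((diagA t : SL(2, ℝ)) : PSL(2, ℝ)) ^ n)
      Filter.atTop (𝓝 1) := by
  have h0 : ((upper 0 : SL(2, ℝ)) : PSL(2, ℝ)) = 1 := (mk_eq_one_iff _).mpr (by simp)
  have h := (continuous_upper.tendsto 0).comp (tendsto_exp_neg_nat_mul ht s)
  rw [h0] at h
  refine h.congr fun n => ?_
  have e := diagA_mul_upper (n * t) (Real.exp (-(n * t)) * s)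
  rw [← mul_assoc, ← Real.exp_add, add_neg_cancel, Real.exp_zero, one_mul] at e
  rw [Function.comp_apply, ← coe_diagA_mul_nat, mul_assoc, eq_inv_mul_iff_mul_eq,
    ← QuotientGroup.mk_mul, e, QuotientGroup.mk_mul]

theorem tendsto_conj_lower {t : ℝ} (ht : 0 < t) (s : ℝ) :
    Filter.Tendsto (fun n : ℕ => (((diagA (-t) : SL(2, ℝ)) : PSL(2, ℝ)) ^ n)⁻¹ *
      ((lower s : SL(2, ℝ)) : PSL(2, ℝ)) * ((diagA (-t) : SL(2, ℝ)) : PSL(2, ℝ)) ^ n)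
      Filter.atTop (𝓝 1) := by
  have h0 : ((lower 0 : SL(2, ℝ)) : PSL(2, ℝ)) = 1 := (mk_eq_one_iff _).mpr (by simp)
  have h := (continuous_lower.tendsto 0).comp (tendsto_exp_neg_nat_mul ht s)
  rw [h0] at h
  refine h.congr fun n => ?_
  have e := diagA_mul_lower (n * -t) (Real.exp (-(n * t)) * s)
  rw [← mul_assoc, ← Real.exp_add, show -(n * -t) + -(n * t) = 0 by ring, Real.exp_zero,
    one_mul] at e
  rw [Function.comp_apply, ← coe_diagA_mul_nat, mul_assoc, eq_inv_mul_iff_mul_eq,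
    ← QuotientGroup.mk_mul, e, QuotientGroup.mk_mul]

theorem diagA_neg_one : ((diagA (-1) : SL(2, ℝ)) : PSL(2, ℝ)) =
    ((diagA 1 : SL(2, ℝ)) : PSL(2, ℝ))⁻¹ := by
  rw [eq_inv_iff_mul_eq_one, ← QuotientGroup.mk_mul, ← diagA_add]
  simp [diagA_zero]

/-- A proper closed subset of `PSL(2, ℝ)` that is invariant under a discrete group of finite coarea
on the left and under the geodesic flow in positive time on the right is a null set. Almost all of
its points stay in the set under right translation by unipotents, hence under a countable dense
set of translations. -/
theorem haarPSL_eq_zero_of_isClosed {G : Subgroup PSL(2, ℝ)} [DiscreteTopology G]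
    (hG : area G ≠ ⊤) {K : Set PSL(2, ℝ)} (hK : IsClosed K)
    (hKG : ∀ g ∈ G, ∀ x ∈ K, g * x ∈ K) (hKa : ∀ x ∈ K, x * (diagA 1 : SL(2, ℝ)) ∈ K)
    (hne : K ≠ univ) : haarPSL K = 0 := by
  set a : PSL(2, ℝ) := ((diagA 1 : SL(2, ℝ)) : PSL(2, ℝ))
  -- Right translations preserve null sets.
  have htr : ∀ {P : PSL(2, ℝ) → Prop}, (∀ᵐ x ∂haarPSL, P x) →
      ∀ p : PSL(2, ℝ), ∀ᵐ x ∂haarPSL, P (x * p) := fun h p =>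
    (measurePreserving_mul_right haarPSL p).quasiMeasurePreserving.ae h
  have hrec₁ := ae_mem_recurrentSet hG 1
  have hrec₂ := ae_mem_recurrentSet hG (-1)
  have hpow : ∀ n : ℕ, ∀ y ∈ K, y * a ^ n ∈ K := by
    intro n
    induction n with
    | zero => intro y hy; simpa using hy
    | succ n ih => intro y hy; rw [pow_succ, ← mul_assoc]; exact hKa _ (ih y hy)
  let M : Submonoid PSL(2, ℝ) :=
    { carrier := {p | ∀ᵐ x ∂haarPSL, x ∈ K → x * p ∈ K}
      one_mem' := by simp
      mul_mem' := by
        intro p q hp hq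
        filter_upwards [hp, htr hq p] with x h₁ h₂ hx
        rw [← mul_assoc]
        exact h₂ (h₁ hx) }
  have hM : ∀ p, p ∈ M := by
    refine submonoid_eq_top (fun s => ?_) (fun s => ?_)
    · filter_upwards [htr hrec₁ (upper s : SL(2, ℝ))] with x h₁ hx
      exact mul_mem_of_recurrent hK hKG (tendsto_conj_upper one_pos s) (fun n => hpow n x hx) h₁
    · have hback : ∀ᵐ x ∂haarPSL, ∀ n : ℕ, x * (a ^ n)⁻¹ ∈ recurrentSet G a :=
        ae_all_iff.mpr fun n => htr hrec₁ (a ^ n)⁻¹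
      filter_upwards [htr hrec₂ (lower s : SL(2, ℝ)), hback] with x h₁ h₂ hx
      refine mul_mem_of_recurrent hK hKG (tendsto_conj_lower one_pos s) (fun n => ?_) h₁
      rw [diagA_neg_one, inv_pow]
      exact mul_pow_inv_mem_of_recurrent hK hKG hKa hx n (h₂ n)
  obtain ⟨D, hDc, hD⟩ := TopologicalSpace.exists_countable_dense PSL(2, ℝ)
  have hall : ∀ᵐ x ∂haarPSL, ∀ p ∈ D, x ∈ K → x * p ∈ K :=
    (ae_ball_iff hDc).mpr fun p _ => hM p
  rw [measure_eq_zero_iff_ae_notMem]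
  filter_upwards [hall] with x hx hxK
  refine hne (eq_univ_of_univ_subset ?_)
  have hdense : Dense ((fun p => x * p) '' D) :=
    (Homeomorph.mulLeft x).surjective.denseRange.dense_image (continuous_const_mul x) hD
  rw [← hdense.closure_eq]
  refine closure_minimal ?_ hK
  rintro _ ⟨p, hp, rfl⟩
  exact hx p hp hxK

/-- Unit tangent vectors whose image in the quotient has a dense forward orbit. -/
def liftedDenseOrbits (G : Subgroup PSL(2, ℝ)) : Set UnitTangent := tangentProj G ⁻¹' denseOrbits G

theorem mem_liftedDenseOrbits_iff {G : Subgroup PSL(2, ℝ)} {v : UnitTangent} :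
    v ∈ liftedDenseOrbits G ↔ ∀ U ∈ TopologicalSpace.countableBasis (SurfaceTangent G),
      v ∈ ⋃ t > (0 : ℝ), flow t ⁻¹' (tangentProj G ⁻¹' U) := by
  have hb := TopologicalSpace.isBasis_countableBasis (SurfaceTangent G)
  change Dense _ ↔ _
  rw [hb.dense_iff]
  refine forall₂_congr fun U hU => ?_
  have hne := TopologicalSpace.nonempty_of_mem_countableBasis hU
  simp only [mem_iUnion, mem_preimage]
  constructor
  · intro h
    obtain ⟨_, hw, t, ht, rfl⟩ := h hne
    exact ⟨t, ht, hw⟩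
  · rintro ⟨t, ht, hw⟩ _
    exact ⟨_, hw, t, ht, rfl⟩

theorem isOpen_hitting_set {G : Subgroup PSL(2, ℝ)} {U : Set (SurfaceTangent G)} (hU : IsOpen U) :
    IsOpen (⋃ t > (0 : ℝ), flow t ⁻¹' (tangentProj G ⁻¹' U)) :=
  isOpen_biUnion fun t _ => (hU.preimage (continuous_tangentProj G)).preimage (continuous_flow t)

theorem measurableSet_liftedDenseOrbits (G : Subgroup PSL(2, ℝ)) :
    MeasurableSet (liftedDenseOrbits G) := by
  have : liftedDenseOrbits G = ⋂ U ∈ TopologicalSpace.countableBasis (SurfaceTangent G),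
      ⋃ t > (0 : ℝ), flow t ⁻¹' (tangentProj G ⁻¹' U) := by
    ext v
    rw [mem_liftedDenseOrbits_iff, mem_iInter₂]
  rw [this]
  exact MeasurableSet.biInter (TopologicalSpace.countable_countableBasis _) fun U hU =>
    (isOpen_hitting_set (TopologicalSpace.isOpen_of_mem_countableBasis hU)).measurableSet

/-- Almost every forward orbit of the geodesic flow on a surface of finite area is dense. -/
theorem ae_mem_liftedDenseOrbits {G : Subgroup PSL(2, ℝ)} [DiscreteTopology G]
    (hG : area G ≠ ⊤) : ∀ᵐ v ∂liouvillePlane, v ∈ liftedDenseOrbits G := by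
  simp only [mem_liftedDenseOrbits_iff]
  refine (ae_ball_iff (TopologicalSpace.countable_countableBasis _)).mpr fun U hU => ?_
  have hUo := TopologicalSpace.isOpen_of_mem_countableBasis hU
  set V := ⋃ t > (0 : ℝ), flow t ⁻¹' (tangentProj G ⁻¹' U) with hV
  change liouvillePlane Vᶜ = 0
  have hmem : ∀ v, v ∈ V ↔ ∃ t > (0 : ℝ), tangentProj G (flow t v) ∈ U := by
    intro v
    simp [hV]
  rw [liouvillePlane_eq_haarPSL]
  refine haarPSL_eq_zero_of_isClosed hG
    ((isOpen_hitting_set hUo).isClosed_compl.preimage orbitHomeo.continuous) ?_ ?_ ?_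
  · intro g hg x hx hgx
    refine hx ?_
    rw [hmem] at hgx ⊢
    obtain ⟨t, ht, h⟩ := hgx
    refine ⟨t, ht, ?_⟩
    rwa [orbitHomeo_apply, mul_smul, flow_smul, tangentProj_smul hg] at h
  · intro x hx hxa
    refine hx ?_
    rw [hmem] at hxa ⊢
    obtain ⟨t, ht, h⟩ := hxa
    refine ⟨t + 1, by positivity, ?_⟩
    rwa [orbitHomeo_apply, ← flow_smul_upI, ← flow_add] at h
  · obtain ⟨w, hw⟩ := TopologicalSpace.nonempty_of_mem_countableBasis hU
    obtain ⟨v, rfl⟩ := tangentProj_surjective G w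
    intro h
    have hx : orbitHomeo.symm (flow (-1) v) ∈ orbitHomeo ⁻¹' Vᶜ := h ▸ mem_univ _
    rw [mem_preimage, Homeomorph.apply_symm_apply, mem_compl_iff, hmem] at hx
    exact hx ⟨1, one_pos, by rwa [← flow_add, add_neg_cancel, flow_zero]⟩

/-! ### The collar lemma -/

/-- The point `e^t i` of the imaginary axis. -/
def axisPt (t : ℝ) : ℍ := base (flow t upI)

theorem axisPt_eq_smul (t : ℝ) : axisPt t = diagA t • UpperHalfPlane.I := by
  rw [axisPt, flow_upI, base_smul_SL, base_upI]

theorem coe_axisPt (t : ℝ) : (axisPt t : ℂ) = Real.exp t * Complex.I := by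
  have h : Real.exp t = Real.exp (t / 2) * Real.exp (t / 2) := by
    rw [← Real.exp_add, add_halves]
  have h' : Real.exp (t / 2) * Real.exp (-(t / 2)) = 1 := by simp [← Real.exp_add]
  have hI : ((UpperHalfPlane.I : ℍ) : ℂ) = Complex.I := rfl
  rw [axisPt_eq_smul, coe_smul, div_eq_iff (den_ne_zero _ _), h, den, hI]
  simp only [diagA_apply, Matrix.of_apply, Matrix.cons_val', Matrix.cons_val_zero,
    Matrix.cons_val_one, Matrix.cons_val_fin_one]
  have h'' : ((Real.exp (t / 2) : ℝ) : ℂ) * ((Real.exp (-(t / 2)) : ℝ) : ℂ) = 1 := by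
    exact_mod_cast h'
  push_cast at h'' ⊢
  linear_combination (-Complex.exp (t / 2) * I) * h''

@[simp] theorem axisPt_re (t : ℝ) : (axisPt t).re = 0 := by
  rw [← UpperHalfPlane.coe_re, coe_axisPt]; simp

@[simp] theorem axisPt_im (t : ℝ) : (axisPt t).im = Real.exp t := by
  rw [← UpperHalfPlane.coe_im, coe_axisPt]
  simp [-Complex.ofReal_exp]

theorem eq_axisPt {z : ℍ} (hz : z.re = 0) : z = axisPt (Real.log z.im) := by
  refine UpperHalfPlane.ext_re_im ?_ ?_
  · rw [axisPt_re, hz]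
  · rw [axisPt_im, Real.exp_log z.im_pos]

theorem diagA_smul_axisPt (s t : ℝ) : diagA s • axisPt t = axisPt (s + t) := by
  rw [axisPt_eq_smul, axisPt_eq_smul, diagA_add, mul_smul]

theorem smul_axisPt (M : SL(2, ℝ)) (t : ℝ) :
    (M • axisPt t).re = (M 0 0 * M 1 0 * Real.exp t ^ 2 + M 0 1 * M 1 1) /
        (M 1 0 ^ 2 * Real.exp t ^ 2 + M 1 1 ^ 2) ∧
      (M • axisPt t).im = Real.exp t / (M 1 0 ^ 2 * Real.exp t ^ 2 + M 1 1 ^ 2) ∧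
      0 < M 1 0 ^ 2 * Real.exp t ^ 2 + M 1 1 ^ 2 := by
  have hdet := M.det_coe
  rw [Matrix.det_fin_two] at hdet
  have hd := den_ne_zero M (axisPt t)
  have hd2 : Complex.normSq (den M (axisPt t)) = M 1 0 ^ 2 * Real.exp t ^ 2 + M 1 1 ^ 2 := by
    rw [den, coe_axisPt, Complex.normSq_apply]
    simp [-Complex.ofReal_exp]
    ring
  have hpos : 0 < M 1 0 ^ 2 * Real.exp t ^ 2 + M 1 1 ^ 2 := hd2 ▸ Complex.normSq_pos.mpr hd
  refine ⟨?_, ?_, hpos⟩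
  · rw [← UpperHalfPlane.coe_re, coe_smul, Complex.div_re, hd2, ← add_div]
    congr 1
    rw [den, coe_axisPt]
    simp [-Complex.ofReal_exp]
    ring
  · rw [← UpperHalfPlane.coe_im, coe_smul, Complex.div_im, hd2, div_sub_div_same]
    congr 1
    rw [den, coe_axisPt]
    simp [-Complex.ofReal_exp]
    linear_combination Real.exp t * hdet

/-- If the image of the imaginary axis under a matrix does not meet the imaginary axis, then its
endpoints lie on the same side. -/
theorem nonneg_of_axis_disjoint {M : SL(2, ℝ)} (h : ∀ t, (M • axisPt t).re ≠ 0) :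
    0 ≤ M 0 0 * M 1 0 * (M 0 1 * M 1 1) ∧ ¬(M 0 0 * M 1 0 = 0 ∧ M 0 1 * M 1 1 = 0) := by
  have h' : ∀ t, M 0 0 * M 1 0 * Real.exp t ^ 2 + M 0 1 * M 1 1 ≠ 0 := by
    intro t h0
    exact h t (by rw [(smul_axisPt M t).1, h0, zero_div])
  refine ⟨?_, fun ⟨h₁, h₂⟩ => h' 0 (by rw [h₁, h₂]; ring)⟩
  by_contra! hneg
  set A := M 0 0 * M 1 0
  set B := M 0 1 * M 1 1
  have hA : A ≠ 0 := by
    rintro h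
    simp [h] at hneg
  have hq : 0 < -B / A := by
    have : -B / A = -(A * B) / A ^ 2 := by field_simp
    rw [this]
    exact div_pos (by linarith) (by positivity)
  refine h' (Real.log (-B / A) / 2) ?_
  rw [← Real.exp_nat_mul, Nat.cast_two, mul_div_cancel₀ _ two_ne_zero, Real.exp_log hq]
  field_simp
  ring

theorem cosh_collarWidth {l : ℝ} (hl : 0 < l) :
    Real.cosh (collarWidth l) = Real.cosh (l / 2) / Real.sinh (l / 2) := by
  have hs : 0 < Real.sinh (l / 4) := Real.sinh_pos_iff.mpr (by positivity)
  have hc : 0 < Real.cosh (l / 4) := Real.cosh_pos _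
  rw [collarWidth, Real.cosh_log (by positivity), show l / 2 = 2 * (l / 4) by ring,
    Real.cosh_two_mul, Real.sinh_two_mul]
  field_simp

/-- The distance of `z` from the imaginary axis is at least `arcosh (|z| / im z)`. -/
theorem one_add_sq_le_cosh_dist_axisPt_sq (s : ℝ) (z : ℍ) :
    1 + (z.re / z.im) ^ 2 ≤ Real.cosh (dist (axisPt s) z) ^ 2 := by
  have hz := z.im_pos
  have he := Real.exp_pos s
  rw [UpperHalfPlane.cosh_dist', axisPt_re, axisPt_im]
  rw [show 1 + (z.re / z.im) ^ 2 = (z.re ^ 2 + z.im ^ 2) / z.im ^ 2 by field_simp; ring, div_pow,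
    div_le_div_iff₀ (by positivity) (by positivity)]
  nlinarith [mul_nonneg (sq_nonneg z.im) (sq_nonneg (z.re ^ 2 + z.im ^ 2 - Real.exp s ^ 2))]

theorem mk_diagA_zpow (l : ℝ) (k : ℤ) :
    ((diagA l : SL(2, ℝ)) : PSL(2, ℝ)) ^ k = ((diagA (k * l) : SL(2, ℝ)) : PSL(2, ℝ)) := by
  have hinv : ∀ t, ((diagA (-t) : SL(2, ℝ)) : PSL(2, ℝ)) = ((diagA t : SL(2, ℝ)) : PSL(2, ℝ))⁻¹ := by
    intro t
    rw [eq_inv_iff_mul_eq_one, ← QuotientGroup.mk_mul, ← diagA_add]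
    simp [diagA_zero]
  obtain ⟨n, rfl | rfl⟩ := k.eq_nat_or_neg
  · rw [zpow_natCast, ← coe_diagA_mul_nat, Int.cast_natCast]
  · rw [zpow_neg, zpow_natCast, ← coe_diagA_mul_nat, ← hinv]
    congr 2
    push_cast
    ring

theorem offDiag_eq_zero {M : SL(2, ℝ)} {t : ℝ}
    (h : (M : PSL(2, ℝ)) = ((diagA t : SL(2, ℝ)) : PSL(2, ℝ))) : M 0 1 = 0 ∧ M 1 0 = 0 := by
  have h1 : ((M * diagA (-t) : SL(2, ℝ)) : PSL(2, ℝ)) = 1 := by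
    rw [QuotientGroup.mk_mul, h, ← QuotientGroup.mk_mul, ← diagA_add]
    simp [diagA_zero]
  obtain ⟨h₂, h₃, -⟩ := (mk_eq_one_iff _).mp h1
  simp only [SL_mul_apply, diagA_apply] at h₂ h₃
  simpa using And.intro h₂ h₃

/-- A discrete group that contains a hyperbolic diagonal element contains no parabolic element that
fixes `∞`: conjugation would contract it to the identity. -/
theorem eq_zero_of_upper_mem {Γ : Subgroup PSL(2, ℝ)} {N : Set PSL(2, ℝ)} (hN : N ∈ 𝓝 1)
    (hΓ : ∀ g ∈ Γ, g ∈ N → g = 1) {l : ℝ} (hl : 0 < l)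
    (hA : ((diagA l : SL(2, ℝ)) : PSL(2, ℝ)) ∈ Γ) {x : ℝ}
    (hx : ((upper x : SL(2, ℝ)) : PSL(2, ℝ)) ∈ Γ) : x = 0 := by
  have h := (tendsto_conj_upper hl x).eventually_mem hN
  obtain ⟨n, hn⟩ := h.exists
  have h1 := hΓ _ (Γ.mul_mem (Γ.mul_mem (Γ.inv_mem (Γ.pow_mem hA n)) hx) (Γ.pow_mem hA n)) hn
  have h2 : ((upper x : SL(2, ℝ)) : PSL(2, ℝ)) = 1 := by
    have := congrArg (fun y => ((diagA l : SL(2, ℝ)) : PSL(2, ℝ)) ^ n * y *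
      (((diagA l : SL(2, ℝ)) : PSL(2, ℝ)) ^ n)⁻¹) h1
    simpa [mul_assoc] using this
  simpa using ((mk_eq_one_iff _).mp h2).1

theorem eq_zero_of_lower_mem {Γ : Subgroup PSL(2, ℝ)} {N : Set PSL(2, ℝ)} (hN : N ∈ 𝓝 1)
    (hΓ : ∀ g ∈ Γ, g ∈ N → g = 1) {l : ℝ} (hl : 0 < l)
    (hA : ((diagA (-l) : SL(2, ℝ)) : PSL(2, ℝ)) ∈ Γ) {x : ℝ}
    (hx : ((lower x : SL(2, ℝ)) : PSL(2, ℝ)) ∈ Γ) : x = 0 := by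
  have h := (tendsto_conj_lower hl x).eventually_mem hN
  obtain ⟨n, hn⟩ := h.exists
  have h1 := hΓ _ (Γ.mul_mem (Γ.mul_mem (Γ.inv_mem (Γ.pow_mem hA n)) hx) (Γ.pow_mem hA n)) hn
  have h2 : ((lower x : SL(2, ℝ)) : PSL(2, ℝ)) = 1 := by
    have := congrArg (fun y => ((diagA (-l) : SL(2, ℝ)) : PSL(2, ℝ)) ^ n * y *
      (((diagA (-l) : SL(2, ℝ)) : PSL(2, ℝ)) ^ n)⁻¹) h1
    simpa [mul_assoc] using this
  simpa using ((mk_eq_one_iff _).mp h2).2.1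

/-- An element that fixes the endpoint `∞` of the imaginary axis fixes the endpoint `0` too: its
commutator with `diagA l` is parabolic. -/
theorem upperRight_eq_zero {Γ : Subgroup PSL(2, ℝ)} {N : Set PSL(2, ℝ)} (hN : N ∈ 𝓝 1)
    (hΓ : ∀ g ∈ Γ, g ∈ N → g = 1) {l : ℝ} (hl : 0 < l)
    (hA : ((diagA l : SL(2, ℝ)) : PSL(2, ℝ)) ∈ Γ) {M : SL(2, ℝ)} (hM : (M : PSL(2, ℝ)) ∈ Γ)
    (h10 : M 1 0 = 0) : M 0 1 = 0 := by
  have hdet := M.det_coe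
  rw [Matrix.det_fin_two, h10, mul_zero, sub_zero] at hdet
  have hLL : Real.exp (l / 2) * Real.exp (-(l / 2)) = 1 := by simp [← Real.exp_add]
  have hL : 1 < Real.exp (l / 2) := by simpa using hl
  have hcomm : M * diagA l * M⁻¹ * (diagA l)⁻¹ =
      upper (M 0 0 * M 0 1 * (1 - Real.exp (l / 2) ^ 2)) := by
    ext i j
    fin_cases i <;> fin_cases j <;> simp [SL_mul_apply, SL_inv_apply, h10]
    · linear_combination hdet + M 0 0 * M 1 1 * hLL
    · linear_combination M 0 0 * M 0 1 * hLL
    · linear_combination hdet + M 0 0 * M 1 1 * hLL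
  have hmem : ((M * diagA l * M⁻¹ * (diagA l)⁻¹ : SL(2, ℝ)) : PSL(2, ℝ)) ∈ Γ :=
    Γ.mul_mem (Γ.mul_mem (Γ.mul_mem hM hA) (Γ.inv_mem hM)) (Γ.inv_mem hA)
  rw [hcomm] at hmem
  have h0 := eq_zero_of_upper_mem hN hΓ hl hA hmem
  have h1 : M 0 0 ≠ 0 := left_ne_zero_of_mul_eq_one hdet
  have h2 : 1 - Real.exp (l / 2) ^ 2 ≠ 0 := by nlinarith
  simpa [h1, h2] using h0

/-- The counterpart of `upperRight_eq_zero` with the endpoints exchanged. -/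
theorem lowerLeft_eq_zero {Γ : Subgroup PSL(2, ℝ)} {N : Set PSL(2, ℝ)} (hN : N ∈ 𝓝 1)
    (hΓ : ∀ g ∈ Γ, g ∈ N → g = 1) {l : ℝ} (hl : 0 < l)
    (hA : ((diagA (-l) : SL(2, ℝ)) : PSL(2, ℝ)) ∈ Γ) {M : SL(2, ℝ)} (hM : (M : PSL(2, ℝ)) ∈ Γ)
    (h01 : M 0 1 = 0) : M 1 0 = 0 := by
  have hdet := M.det_coe
  rw [Matrix.det_fin_two, h01, zero_mul, sub_zero] at hdet
  have hLL : Real.exp (-l / 2) * Real.exp (-(-l / 2)) = 1 := by simp [← Real.exp_add]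
  have hL : 1 < Real.exp (-(-l / 2)) := Real.one_lt_exp_iff.mpr (by linarith)
  have hcomm : M * diagA (-l) * M⁻¹ * (diagA (-l))⁻¹ =
      lower (M 1 0 * M 1 1 * (1 - Real.exp (-(-l / 2)) ^ 2)) := by
    ext i j
    fin_cases i <;> fin_cases j <;> simp [SL_mul_apply, SL_inv_apply, h01, -mul_eq_zero]
    · linear_combination hdet + M 0 0 * M 1 1 * hLL
    · linear_combination M 1 0 * M 1 1 * hLL
    · linear_combination hdet + M 0 0 * M 1 1 * hLL
  have hmem : ((M * diagA (-l) * M⁻¹ * (diagA (-l))⁻¹ : SL(2, ℝ)) : PSL(2, ℝ)) ∈ Γ :=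
    Γ.mul_mem (Γ.mul_mem (Γ.mul_mem hM hA) (Γ.inv_mem hM)) (Γ.inv_mem hA)
  rw [hcomm] at hmem
  have h0 := eq_zero_of_lower_mem hN hΓ hl hA hmem
  have h1 : M 1 1 ≠ 0 := right_ne_zero_of_mul_eq_one hdet
  have h2 : 1 - Real.exp (-(-l / 2)) ^ 2 ≠ 0 := by nlinarith
  simpa [h1, h2] using h0

/-- If a geodesic and its image under the translation with multipliers `L` and `L' = 1 / L` are
disjoint, then the cross-ratio of its endpoints and those of the axis is bounded from below. -/
theorem one_le_of_translate_disjoint {a b c d L L' : ℝ} (hL : L * L' = 1) (hne : L - L' ≠ 0)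
    (hdet : a * d - b * c = 1) (hpos : 0 < a * c * (b * d))
    (h : 0 ≤ (L * (a * d) - L' * (b * c)) * (-(L - L') * (a * c)) *
      ((L - L') * (b * d) * (L' * (a * d) - L * (b * c)))) :
    1 ≤ (L - L') ^ 2 * (a * c * (b * d)) := by
  have h1 : 0 < (L - L') ^ 2 * (a * c * (b * d)) := by positivity
  have h2 : (L * (a * d) - L' * (b * c)) * (L' * (a * d) - L * (b * c)) ≤ 0 := by
    by_contra! h2
    have := mul_pos h1 h2
    linarith
  have h3 : (L * (a * d) - L' * (b * c)) * (L' * (a * d) - L * (b * c)) =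
      (a * d - b * c) ^ 2 - (L - L') ^ 2 * (a * c * (b * d)) +
      (L * L' - 1) * ((a * d) ^ 2 + (b * c) ^ 2 - 2 * (a * c * (b * d))) := by ring
  rw [hL, hdet] at h3
  linarith

/-- A lower bound for the distance between the imaginary axis and a translate of it. -/
theorem one_add_le_cosh_dist_smul_axisPt_sq (M : SL(2, ℝ)) (s t : ℝ) :
    1 + 4 * (M 0 0 * M 1 0 * (M 0 1 * M 1 1)) ≤
      Real.cosh (dist (axisPt s) (M • axisPt t)) ^ 2 := by
  obtain ⟨hre, him, hden⟩ := smul_axisPt M t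
  have hτ := Real.exp_pos t
  have h : (M • axisPt t).re / (M • axisPt t).im =
      (M 0 0 * M 1 0 * Real.exp t ^ 2 + M 0 1 * M 1 1) / Real.exp t := by
    rw [hre, him]
    field_simp
  refine le_trans ?_ (one_add_sq_le_cosh_dist_axisPt_sq s (M • axisPt t))
  rw [h, div_pow, add_le_add_iff_left, le_div_iff₀ (by positivity)]
  linarith [sq_nonneg (M 0 0 * M 1 0 * Real.exp t ^ 2 - M 0 1 * M 1 1)]

/-- The collar lemma. Let the imaginary axis project to a simple closed geodesic of length `l`. A
translate of the axis other than the axis itself has distance at least `log coth (l / 4)` from it.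
Otherwise the translate would intersect its image under the translation of length `l` along the
axis. -/
theorem mem_zpowers_of_dist_lt {Γ : Subgroup PSL(2, ℝ)} {N : Set PSL(2, ℝ)} (hN : N ∈ 𝓝 1)
    (hΓ : ∀ g ∈ Γ, g ∈ N → g = 1) {l : ℝ} (hl : 0 < l)
    (hA : ((diagA l : SL(2, ℝ)) : PSL(2, ℝ)) ∈ Γ)
    (hsimple : ∀ g ∈ Γ, ∀ s t, g • axisPt t = axisPt s →
      ∃ k : ℤ, g = ((diagA (k * l) : SL(2, ℝ)) : PSL(2, ℝ)))
    {g : PSL(2, ℝ)} (hg : g ∈ Γ) {s t : ℝ} (hd : dist (axisPt s) (g • axisPt t) < collarWidth l) :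
    ∃ k : ℤ, g = ((diagA (k * l) : SL(2, ℝ)) : PSL(2, ℝ)) := by
  by_contra hgk
  have hoff : ∀ M : SL(2, ℝ), (M : PSL(2, ℝ)) ∈ Γ →
      (¬∃ k : ℤ, (M : PSL(2, ℝ)) = ((diagA (k * l) : SL(2, ℝ)) : PSL(2, ℝ))) →
      0 ≤ M 0 0 * M 1 0 * (M 0 1 * M 1 1) ∧ ¬(M 0 0 * M 1 0 = 0 ∧ M 0 1 * M 1 1 = 0) := by
    intro M hM hMk
    refine nonneg_of_axis_disjoint fun t ht => hMk ?_
    exact hsimple _ hM _ t (eq_axisPt ht)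
  have hA' : ((diagA (-l) : SL(2, ℝ)) : PSL(2, ℝ)) ∈ Γ := by
    have := Γ.inv_mem hA
    rwa [← zpow_neg_one, mk_diagA_zpow, Int.cast_neg, Int.cast_one, neg_one_mul] at this
  induction g using QuotientGroup.induction_on with
  | H M =>
    have hdet := M.det_coe
    rw [Matrix.det_fin_two] at hdet
    obtain ⟨hnn, hnz⟩ := hoff M hg hgk
    set a := M 0 0 with ha
    set b := M 0 1 with hb
    set c := M 1 0 with hc
    set d := M 1 1 with hd'
    have hs : 0 < Real.sinh (l / 2) := Real.sinh_pos_iff.mpr (by positivity)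
    set L := Real.exp (l / 2) with hL
    set L' := Real.exp (-(l / 2)) with hL'
    have hLL' : L * L' = 1 := by simp [hL, hL', ← Real.exp_add]
    have hsub : L - L' = 2 * Real.sinh (l / 2) := by rw [Real.sinh_eq]; ring
    have hsub_ne : L - L' ≠ 0 := by rw [hsub]; positivity
    -- The translate and the axis have no common endpoint.
    have hW : ((M * diagA l * M⁻¹ : SL(2, ℝ)) : PSL(2, ℝ)) ∈ Γ :=
      Γ.mul_mem (Γ.mul_mem hg hA) (Γ.inv_mem hg)
    have hW10 : (M * diagA l * M⁻¹) 1 0 = (L - L') * (c * d) := by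
      simp [SL_mul_apply, SL_inv_apply, ← hL, ← hL', ← hc, ← hd']
      ring
    have hW01 : (M * diagA l * M⁻¹) 0 1 = -(L - L') * (a * b) := by
      simp [SL_mul_apply, SL_inv_apply, ← hL, ← hL', ← ha, ← hb]
      ring
    have hcd : c * d = 0 → a * b = 0 := fun h0 => by
      have := upperRight_eq_zero hN hΓ hl hA hW (by rw [hW10, h0, mul_zero])
      rw [hW01] at this
      exact (mul_eq_zero.mp this).resolve_left (neg_ne_zero.mpr hsub_ne)
    have hab : a * b = 0 → c * d = 0 := fun h0 => by
      have := lowerLeft_eq_zero hN hΓ hl hA' hW (by rw [hW01, h0, mul_zero])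
      rw [hW10] at this
      exact (mul_eq_zero.mp this).resolve_left hsub_ne
    have hpos : 0 < a * c * (b * d) := by
      refine lt_of_le_of_ne hnn fun h0 => ?_
      have h1 : c * d = 0 ∧ a * b = 0 := by
        have : (c * d) * (a * b) = 0 := by rw [h0]; ring
        rcases mul_eq_zero.mp this with h | h
        · exact ⟨h, hcd h⟩
        · exact ⟨hab h, h⟩
      rcases mul_eq_zero.mp h1.1 with h | h <;> rcases mul_eq_zero.mp h1.2 with h' | h' <;>
        simp [h, h'] at hdet hnz
    -- The translate of the axis and its image under the translation along the axis are disjoint.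
    have e00 : (M⁻¹ * diagA l * M) 0 0 = L * (a * d) - L' * (b * c) := by
      simp [SL_mul_apply, SL_inv_apply, ← hL, ← hL', ← ha, ← hb, ← hc, ← hd']
      ring
    have e01 : (M⁻¹ * diagA l * M) 0 1 = (L - L') * (b * d) := by
      simp [SL_mul_apply, SL_inv_apply, ← hL, ← hL', ← hb, ← hd']
      ring
    have e10 : (M⁻¹ * diagA l * M) 1 0 = -(L - L') * (a * c) := by
      simp [SL_mul_apply, SL_inv_apply, ← hL, ← hL', ← ha, ← hc]
      ring
    have e11 : (M⁻¹ * diagA l * M) 1 1 = L' * (a * d) - L * (b * c) := by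
      simp [SL_mul_apply, SL_inv_apply, ← hL, ← hL', ← ha, ← hb, ← hc, ← hd']
      ring
    have hK := (hoff (M⁻¹ * diagA l * M) (Γ.mul_mem (Γ.mul_mem (Γ.inv_mem hg) hA) hg) (by
      rintro ⟨k, hk⟩
      obtain ⟨h01, h10⟩ := offDiag_eq_zero hk
      rw [e01] at h01
      have := (mul_eq_zero.mp h01).resolve_left hsub_ne
      rw [this, mul_zero] at hpos
      exact lt_irrefl _ hpos)).1
    rw [e00, e01, e10, e11] at hK
    have hbound := one_le_of_translate_disjoint hLL' hsub_ne hdet hpos hK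
    rw [hsub] at hbound
    have h1 := one_add_le_cosh_dist_smul_axisPt_sq M s t
    have h2 : Real.cosh (dist (axisPt s) (M • axisPt t)) < Real.cosh (collarWidth l) := by
      rw [Real.cosh_lt_cosh, abs_of_nonneg dist_nonneg]
      exact hd.trans_le (le_abs_self _)
    have h3 : Real.cosh (dist (axisPt s) (M • axisPt t)) ^ 2 < Real.cosh (collarWidth l) ^ 2 :=
      pow_lt_pow_left₀ h2 (Real.cosh_pos _).le two_ne_zero
    rw [cosh_collarWidth hl, div_pow, Real.cosh_sq (l / 2), lt_div_iff₀ (by positivity)] at h3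
    have h4 := mul_le_mul_of_nonneg_right h1 (sq_nonneg (Real.sinh (l / 2)))
    linarith

/-! ### Flow boxes over the imaginary axis -/

theorem re_sq_add_im_sq (u : Circle) : (u : ℂ).re ^ 2 + (u : ℂ).im ^ 2 = 1 := by
  have := Circle.normSq_coe u
  rw [Complex.normSq_apply] at this
  linarith

theorem cosh_eq_half (t : ℝ) : Real.cosh t = Real.cosh (t / 2) ^ 2 + Real.sinh (t / 2) ^ 2 := by
  rw [← Real.cosh_two_mul, mul_div_cancel₀ t two_ne_zero]

theorem sinh_eq_half (t : ℝ) : Real.sinh t = 2 * Real.sinh (t / 2) * Real.cosh (t / 2) := by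
  rw [← Real.sinh_two_mul, mul_div_cancel₀ t two_ne_zero]

theorem flowDen_re (t : ℝ) (u : Circle) :
    (flowDen t u).re = Real.cosh (t / 2) - (u : ℂ).im * Real.sinh (t / 2) := by
  simp [flowDen, -Complex.ofReal_cosh, -Complex.ofReal_sinh]
  ring

theorem flowDen_im (t : ℝ) (u : Circle) :
    (flowDen t u).im = (u : ℂ).re * Real.sinh (t / 2) := by
  simp [flowDen, -Complex.ofReal_cosh, -Complex.ofReal_sinh]

theorem normSq_flowDen_neg (t : ℝ) (u : Circle) :
    Complex.normSq (flowDen (-t) u) = Real.cosh t + (u : ℂ).im * Real.sinh t := by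
  rw [Complex.normSq_apply, flowDen_re, flowDen_im, neg_div, Real.cosh_neg, Real.sinh_neg,
    cosh_eq_half t, sinh_eq_half t]
  linear_combination Real.sinh (t / 2) ^ 2 * re_sq_add_im_sq u

theorem cosh_add_mul_sinh_pos (t : ℝ) (u : Circle) :
    0 < Real.cosh t + (u : ℂ).im * Real.sinh t := by
  rw [← normSq_flowDen_neg]
  exact Complex.normSq_pos.mpr (flowDen_ne_zero _ _)

theorem base_flow_neg_im (t : ℝ) (v : UnitTangent) :
    (base (flow (-t) v)).im = (base v).im / (Real.cosh t + (dir v : ℂ).im * Real.sinh t) := by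
  rw [← UpperHalfPlane.coe_im, coe_base_flow, flowNum_div_im, normSq_flowDen_neg]

theorem base_flow_neg_re (t : ℝ) (v : UnitTangent) :
    (base (flow (-t) v)).re = ((base v).re * (Real.cosh t + (dir v : ℂ).im * Real.sinh t) -
      (base v).im * ((dir v : ℂ).re * Real.sinh t)) /
        (Real.cosh t + (dir v : ℂ).im * Real.sinh t) := by
  rw [← UpperHalfPlane.coe_re, coe_base_flow, Complex.div_re, normSq_flowDen_neg, ← add_div]
  congr 1
  rw [flowDen_re, flowDen_im, neg_div, Real.cosh_neg, Real.sinh_neg, cosh_eq_half t, sinh_eq_half t]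
  simp [flowNum, -Complex.ofReal_cosh, -Complex.ofReal_sinh, neg_div]
  linear_combination (base v).re * Real.sinh (t / 2) ^ 2 * re_sq_add_im_sq (dir v)

theorem dir_flow_neg_re (t : ℝ) (v : UnitTangent) :
    (dir (flow (-t) v) : ℂ).re =
      (dir v : ℂ).re / (Real.cosh t + (dir v : ℂ).im * Real.sinh t) := by
  rw [coe_dir_flow, ← mul_div_assoc, Complex.div_re, normSq_flowDen_neg, ← add_div]
  congr 1
  simp only [Complex.mul_re, Complex.mul_im, Complex.conj_re, Complex.conj_im]
  rw [flowDen_re, flowDen_im, neg_div, Real.cosh_neg, Real.sinh_neg]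
  linear_combination (dir v : ℂ).re * Real.cosh_sq (t / 2) -
    (dir v : ℂ).re * Real.sinh (t / 2) ^ 2 * re_sq_add_im_sq (dir v)

/-- The function `t ↦ p sinh t / (cosh t + q sinh t)` is injective: a geodesic crosses the imaginary
axis at most once. -/
theorem mul_sinh_div_inj {u : Circle} (hp : 0 < (u : ℂ).re) {t t' : ℝ}
    (h : (u : ℂ).re * Real.sinh t / (Real.cosh t + (u : ℂ).im * Real.sinh t) =
      (u : ℂ).re * Real.sinh t' / (Real.cosh t' + (u : ℂ).im * Real.sinh t')) : t = t' := by
  rw [div_eq_div_iff (cosh_add_mul_sinh_pos t u).ne' (cosh_add_mul_sinh_pos t' u).ne'] at h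
  have h' : Real.sinh (t - t') = 0 := by
    rw [Real.sinh_sub]
    refine mul_left_cancel₀ hp.ne' ?_
    linear_combination h
  exact sub_eq_zero.mp (Real.sinh_eq_zero.mp h')

theorem mul_sinh_div_mem_iff {u : Circle} (hp : 0 < (u : ℂ).re) {ε : ℝ} (hε : 0 ≤ ε) (X : ℝ) :
    (∃ t ∈ Icc 0 ε, X = (u : ℂ).re * Real.sinh t / (Real.cosh t + (u : ℂ).im * Real.sinh t)) ↔
      X ∈ Icc 0 ((u : ℂ).re * Real.sinh ε / (Real.cosh ε + (u : ℂ).im * Real.sinh ε)) := by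
  constructor
  · rintro ⟨t, ht, rfl⟩
    have h0 : 0 ≤ Real.sinh t := Real.sinh_nonneg_iff.mpr ht.1
    have h1 := cosh_add_mul_sinh_pos t u
    refine ⟨by positivity, ?_⟩
    rw [div_le_div_iff₀ h1 (cosh_add_mul_sinh_pos ε u)]
    have h2 : 0 ≤ Real.sinh (ε - t) := Real.sinh_nonneg_iff.mpr (sub_nonneg.mpr ht.2)
    rw [Real.sinh_sub] at h2
    have h3 := mul_nonneg hp.le h2
    linarith
  · intro hX
    have hc : ContinuousOn
        (fun t => (u : ℂ).re * Real.sinh t / (Real.cosh t + (u : ℂ).im * Real.sinh t))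
        (Icc 0 ε) := by
      refine Continuous.continuousOn (Continuous.div₀ ?_ ?_ fun t => (cosh_add_mul_sinh_pos t u).ne')
      · exact continuous_const.mul Real.continuous_sinh
      · exact Real.continuous_cosh.add (continuous_const.mul Real.continuous_sinh)
    have h := intermediate_value_Icc hε hc
    simp only [Real.sinh_zero, mul_zero, zero_div] at h
    obtain ⟨t, ht, h'⟩ := h hX
    exact ⟨t, ht, h'.symm⟩

theorem continuous_diagA : Continuous fun t : ℝ => ((diagA t : SL(2, ℝ)) : PSL(2, ℝ)) := by
  refine QuotientGroup.continuous_mk.comp (Continuous.subtype_mk ?_ _)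
  exact continuous_matrix (by intro i j; fin_cases i <;> fin_cases j <;> simp <;> fun_prop)

theorem continuous_flow_uncurry : Continuous fun q : ℝ × UnitTangent => flow q.1 q.2 := by
  have : (fun q : ℝ × UnitTangent => flow q.1 q.2) =
      fun q => orbitHomeo (orbitHomeo.symm q.2 * (diagA q.1 : SL(2, ℝ))) := by
    ext q
    obtain ⟨x, hx⟩ := orbitHomeo.surjective q.2
    rw [← hx, Homeomorph.symm_apply_apply, orbitHomeo_apply, orbitHomeo_apply, flow_smul_upI]
  rw [this]
  exact orbitHomeo.continuous.comp ((orbitHomeo.symm.continuous.comp continuous_snd).mul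
    (continuous_diagA.comp continuous_fst))

theorem continuous_axisPt : Continuous axisPt := by
  have h : Continuous fun t : ℝ => (t, upI) := by fun_prop
  change Continuous fun t => base (flow t upI)
  simpa only [Function.comp_def] using continuous_base.comp (continuous_flow_uncurry.comp h)

theorem continuous_vec_axisPt : Continuous fun q : ℝ × Circle × ℝ => vec (axisPt q.1) q.2.1 := by
  refine continuous_vec_iff.mpr ⟨?_, ?_⟩
  · exact UpperHalfPlane.continuous_coe.comp (continuous_axisPt.comp continuous_fst)
  · exact continuous_subtype_val.comp (continuous_fst.comp continuous_snd)

theorem continuous_flow_vec_axisPt :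
    Continuous fun q : ℝ × Circle × ℝ => flow q.2.2 (vec (axisPt q.1) q.2.1) := by
  have h : Continuous fun q : ℝ × Circle × ℝ => (q.2.2, vec (axisPt q.1) q.2.1) :=
    (continuous_snd.comp continuous_snd).prodMk continuous_vec_axisPt
  simpa only [Function.comp_def] using continuous_flow_uncurry.comp h

theorem axisPt_injective : Function.Injective axisPt := by
  intro s t h
  have := congrArg UpperHalfPlane.im h
  simpa using this

theorem re_div_im_flow_axisPt (s t : ℝ) (u : Circle) (v : UnitTangent)
    (h : flow t (vec (axisPt s) u) = v) : (base v).re / (base v).im =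
      (dir v : ℂ).re * Real.sinh t / (Real.cosh t + (dir v : ℂ).im * Real.sinh t) := by
  have hN := cosh_add_mul_sinh_pos t (dir v)
  have hw : flow (-t) v = vec (axisPt s) u := by rw [← h, ← flow_add, neg_add_cancel, flow_zero]
  have h1 := base_flow_neg_re t v
  rw [hw, base_vec, axisPt_re, eq_comm, div_eq_zero_iff, or_iff_left hN.ne', sub_eq_zero] at h1
  rw [div_eq_div_iff (base v).im_pos.ne' hN.ne', h1, mul_comm]

theorem dir_re_pos_of_flow (t : ℝ) {w v : UnitTangent} (h : flow t w = v) :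
    0 < (dir w : ℂ).re ↔ 0 < (dir v : ℂ).re := by
  have hw : flow (-t) v = w := by rw [← h, ← flow_add, neg_add_cancel, flow_zero]
  rw [← hw, dir_flow_neg_re, div_pos_iff_of_pos_right (cosh_add_mul_sinh_pos t (dir v))]

/-- A vector is reached from the imaginary axis in at most one way. -/
theorem flow_axisPt_inj {s s' t t' : ℝ} {u u' : Circle} (hu : 0 < (u : ℂ).re)
    (h : flow t (vec (axisPt s) u) = flow t' (vec (axisPt s') u')) :
    s = s' ∧ u = u' ∧ t = t' := by
  have hp := (dir_re_pos_of_flow t (w := vec (axisPt s) u) rfl).mp hu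
  have ht : t = t' := by
    refine mul_sinh_div_inj hp ?_
    rw [← re_div_im_flow_axisPt s t u _ rfl, h, ← re_div_im_flow_axisPt s' t' u' _ rfl]
  subst ht
  have h' := (flowHomeo t).injective h
  have h1 : axisPt s = axisPt s' := by rw [← base_vec (axisPt s) u, h', base_vec]
  have h2 : u = u' := by rw [← dir_vec (axisPt s) u, h', dir_vec]
  exact ⟨axisPt_injective h1, h2, rfl⟩

/-- The flow box over the segment of the imaginary axis between `i` and `e^l i`: the vectors with
base point on the segment that point to the right and belong to `E`, moved by the geodesic flow for
times in `[0, ε]`. -/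
def flowBox (E : Set UnitTangent) (l ε : ℝ) : Set UnitTangent :=
  {v | ∃ s ∈ Ico 0 l, ∃ u : Circle, 0 < (u : ℂ).re ∧ vec (axisPt s) u ∈ E ∧
    ∃ t ∈ Icc 0 ε, flow t (vec (axisPt s) u) = v}

theorem mem_flowBox_iff {E : Set UnitTangent} {l ε : ℝ} {v : UnitTangent} :
    v ∈ flowBox E l ε ↔ 0 < (dir v : ℂ).re ∧ ∃ t ∈ Icc 0 ε,
      (base v).re / (base v).im =
        (dir v : ℂ).re * Real.sinh t / (Real.cosh t + (dir v : ℂ).im * Real.sinh t) ∧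
      Real.log (base v).im - Real.log (Real.cosh t + (dir v : ℂ).im * Real.sinh t) ∈ Ico 0 l ∧
      flow (-t) v ∈ E := by
  have hcancel : ∀ t v, flow t (flow (-t) v) = v := fun t v => by
    rw [← flow_add, add_neg_cancel, flow_zero]
  have hcancel' : ∀ t v, flow (-t) (flow t v) = v := fun t v => by
    rw [← flow_add, neg_add_cancel, flow_zero]
  have hy := (base v).im_pos
  have hre : ∀ t, (base (flow (-t) v)).re = 0 ↔ (base v).re / (base v).im =
      (dir v : ℂ).re * Real.sinh t / (Real.cosh t + (dir v : ℂ).im * Real.sinh t) := by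
    intro t
    have hN := cosh_add_mul_sinh_pos t (dir v)
    rw [base_flow_neg_re, div_eq_zero_iff, or_iff_left hN.ne', sub_eq_zero,
      div_eq_div_iff hy.ne' hN.ne', mul_comm (base v).im]
  have hlog : ∀ t, Real.log (base (flow (-t) v)).im = Real.log (base v).im -
      Real.log (Real.cosh t + (dir v : ℂ).im * Real.sinh t) := by
    intro t
    rw [base_flow_neg_im, Real.log_div hy.ne' (cosh_add_mul_sinh_pos t (dir v)).ne']
  constructor
  · rintro ⟨s, hs, u, hu, hE, t, ht, hv⟩
    have hw : flow (-t) v = vec (axisPt s) u := by rw [← hv, hcancel']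
    refine ⟨(dir_re_pos_of_flow t hv).mp hu, t, ht, re_div_im_flow_axisPt s t u v hv, ?_, hw ▸ hE⟩
    · rw [← hlog, hw, base_vec, axisPt_im, Real.log_exp]
      exact hs
  · rintro ⟨hp, t, ht, hX, hη, hE⟩
    have hvec : vec (axisPt (Real.log (base (flow (-t) v)).im)) (dir (flow (-t) v)) =
        flow (-t) v := UnitTangent.ext (eq_axisPt ((hre t).mpr hX)).symm rfl
    refine ⟨Real.log (base (flow (-t) v)).im, ?_, dir (flow (-t) v), ?_, ?_, t, ht, ?_⟩
    · rw [hlog]; exact hη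
    · rw [dir_flow_neg_re]
      exact div_pos hp (cosh_add_mul_sinh_pos t (dir v))
    · rwa [hvec]
    · rw [hvec, hcancel]

theorem measurableSet_flowBox {E : Set UnitTangent} (hE : MeasurableSet E) (l ε : ℝ) :
    MeasurableSet (flowBox E l ε) := by
  have hre : Continuous fun u : Circle => (u : ℂ).re :=
    Complex.continuous_re.comp continuous_subtype_val
  have hpos : MeasurableSet {u : Circle | 0 < (u : ℂ).re} :=
    (isOpen_lt continuous_const hre).measurableSet
  have hSm : MeasurableSet ((Ico 0 l ×ˢ {u : Circle | 0 < (u : ℂ).re} ×ˢ Icc 0 ε) ∩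
      (fun q : ℝ × Circle × ℝ => vec (axisPt q.1) q.2.1) ⁻¹' E) :=
    (measurableSet_Ico.prod (hpos.prod measurableSet_Icc)).inter
      (continuous_vec_axisPt.measurable hE)
  have himage : flowBox E l ε = (fun q : ℝ × Circle × ℝ => flow q.2.2 (vec (axisPt q.1) q.2.1)) ''
      ((Ico 0 l ×ˢ {u : Circle | 0 < (u : ℂ).re} ×ˢ Icc 0 ε) ∩
      (fun q : ℝ × Circle × ℝ => vec (axisPt q.1) q.2.1) ⁻¹' E) := by
    ext v
    constructor
    · rintro ⟨s, hs, u, hu, hE, t, ht, hv⟩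
      exact ⟨(s, u, t), ⟨⟨hs, hu, ht⟩, hE⟩, hv⟩
    · rintro ⟨⟨s, u, t⟩, ⟨⟨hs, hu, ht⟩, hE⟩, hv⟩
      exact ⟨s, hs, u, hu, hE, t, ht, hv⟩
  rw [himage]
  refine hSm.image_of_continuousOn_injOn continuous_flow_vec_axisPt.continuousOn ?_
  rintro ⟨s, u, t⟩ ⟨⟨hs, hu, ht⟩, -⟩ ⟨s', u', t'⟩ - h
  obtain ⟨rfl, rfl, rfl⟩ := flow_axisPt_inj hu h
  rfl

/-! ### The Liouville measure of a flow box -/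

/-- The point `e^η (X + i)` of the hyperbolic plane. -/
def slopePt (q : ℝ × ℝ) : ℍ := ⟨⟨q.1 * Real.exp q.2, Real.exp q.2⟩, Real.exp_pos _⟩

@[simp] theorem slopePt_re (q : ℝ × ℝ) : (slopePt q).re = q.1 * Real.exp q.2 := rfl
@[simp] theorem slopePt_im (q : ℝ × ℝ) : (slopePt q).im = Real.exp q.2 := rfl

theorem continuous_slopePt : Continuous slopePt := by
  refine UpperHalfPlane.isEmbedding_coe.continuous_iff.mpr ?_
  have : (((↑) : ℍ → ℂ) ∘ slopePt) = fun q : ℝ × ℝ =>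
      Complex.equivRealProdCLM.symm (q.1 * Real.exp q.2, Real.exp q.2) := by
    ext q
    apply Complex.ext <;> simp [slopePt]
  rw [this]
  fun_prop

theorem slopePt_eq {z : ℍ} : slopePt (z.re / z.im, Real.log z.im) = z := by
  refine UpperHalfPlane.ext_re_im ?_ ?_
  · rw [slopePt_re, Real.exp_log z.im_pos, div_mul_cancel₀ _ z.im_pos.ne']
  · rw [slopePt_im, Real.exp_log z.im_pos]

theorem lintegral_Ioi_inv_mul_comp_log (g : ℝ → ENNReal) :
    ∫⁻ y in Ioi (0 : ℝ), ENNReal.ofReal y⁻¹ * g (Real.log y) = ∫⁻ η, g η := by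
  have h := lintegral_image_eq_lintegral_abs_deriv_mul (s := univ) MeasurableSet.univ
    (fun x _ => (Real.hasDerivAt_exp x).hasDerivWithinAt) Real.exp_injective.injOn
    (fun y => ENNReal.ofReal y⁻¹ * g (Real.log y))
  rw [image_univ, Real.range_exp, Measure.restrict_univ] at h
  rw [h]
  refine lintegral_congr fun η => ?_
  rw [Real.log_exp, ← mul_assoc, ← ENNReal.ofReal_mul (abs_nonneg _), abs_of_pos (Real.exp_pos η),
    mul_inv_cancel₀ (Real.exp_pos η).ne', ENNReal.ofReal_one, one_mul]

/-- The hyperbolic area is `dX dη` in the coordinates `X = x / y` and `η = log y`. -/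
theorem volume_eq_volume_slopePt_preimage {A : Set ℍ} (hA : MeasurableSet A) :
    (volume : Measure ℍ) A = volume (slopePt ⁻¹' A) := by
  have hA' : MeasurableSet (((↑) : ℍ → ℂ) '' A) :=
    UpperHalfPlane.measurableEmbedding_coe.measurableSet_image.mpr hA
  have hB : MeasurableSet (slopePt ⁻¹' A) := continuous_slopePt.measurable hA
  set f : ℂ → ENNReal := (((↑) : ℍ → ℂ) '' A).indicator
    fun z : ℂ => (((1 / ‖z.im‖₊) ^ 2 : NNReal) : ENNReal) with hf
  have hfm : Measurable f := by
    refine Measurable.indicator ?_ hA'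
    fun_prop
  have hfm' : Measurable fun q : ℝ × ℝ => f (Complex.measurableEquivRealProd.symm q) :=
    hfm.comp Complex.measurableEquivRealProd.symm.measurable
  rw [UpperHalfPlane.volume_eq_lintegral, ← lintegral_indicator hA',
    ← Complex.volume_preserving_equiv_real_prod.symm.lintegral_comp hfm, Measure.volume_eq_prod,
    lintegral_prod_symm _ hfm'.aemeasurable,
    Measure.prod_apply_symm hB,
    ← lintegral_Ioi_inv_mul_comp_log (fun η => volume ((fun X => (X, η)) ⁻¹' (slopePt ⁻¹' A))),
    ← lintegral_indicator measurableSet_Ioi]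
  refine lintegral_congr fun y => ?_
  have hval : ∀ x, f (Complex.measurableEquivRealProd.symm (x, y)) = f ⟨x, y⟩ := fun x => rfl
  simp only [hval]
  by_cases hy : 0 < y
  · rw [indicator_of_mem (mem_Ioi.mpr hy)]
    have hmem : ∀ x : ℝ, (⟨x, y⟩ : ℂ) ∈ ((↑) : ℍ → ℂ) '' A ↔
        slopePt (x / y, Real.log y) ∈ A := by
      intro x
      have e : slopePt (x / y, Real.log y) = ⟨⟨x, y⟩, hy⟩ := by
        exact slopePt_eq (z := ⟨⟨x, y⟩, hy⟩)
      rw [e]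
      constructor
      · rintro ⟨z, hz, hzx⟩
        have : z = ⟨⟨x, y⟩, hy⟩ := UpperHalfPlane.ext hzx
        rwa [← this]
      · exact fun h => ⟨_, h, rfl⟩
    have hfx : ∀ x, f ⟨x, y⟩ = ((fun x => y⁻¹ * x) ⁻¹'
        {X | slopePt (X, Real.log y) ∈ A}).indicator (fun _ => ENNReal.ofReal (y⁻¹ ^ 2)) x := by
      intro x
      rw [hf]
      by_cases hx : slopePt (x / y, Real.log y) ∈ A
      · rw [indicator_of_mem ((hmem x).mpr hx), indicator_of_mem]
        · rw [ENNReal.ofReal, ENNReal.coe_inj]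
          ext
          rw [Real.coe_toNNReal _ (by positivity)]
          simp
        · rwa [mem_preimage, mem_ofPred_eq, inv_mul_eq_div]
      · rw [indicator_of_notMem (fun h => hx ((hmem x).mp h)), indicator_of_notMem]
        rwa [mem_preimage, mem_ofPred_eq, inv_mul_eq_div]
    have hS : MeasurableSet {X : ℝ | slopePt (X, Real.log y) ∈ A} :=
      measurable_prodMk_right hB
    simp only [hfx]
    rw [lintegral_indicator_const ((measurable_const_mul _) hS),
      Real.volume_preimage_mul_left (inv_ne_zero hy.ne'), inv_inv, abs_of_pos hy, ← mul_assoc,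
      ← ENNReal.ofReal_mul (by positivity)]
    congr 2
    field_simp
  · rw [indicator_of_notMem (by simpa using hy)]
    have : ∀ x, f ⟨x, y⟩ = 0 := by
      intro x
      refine indicator_of_notMem ?_ _
      rintro ⟨z, -, hz⟩
      exact hy (by rw [show y = z.im by rw [← UpperHalfPlane.coe_im, hz]]; exact z.im_pos)
    simp [this]

/-- The area of the set of base points of the vectors with direction `u` in a flow box. -/
theorem volume_slice_flowBox {l ε : ℝ} (hε : 0 ≤ ε) (u : Circle) :
    (volume : Measure ℍ) {z | vec z u ∈ flowBox univ l ε} =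
      if 0 < (u : ℂ).re then ENNReal.ofReal l * ENNReal.ofReal ((u : ℂ).re * Real.sinh ε /
        (Real.cosh ε + (u : ℂ).im * Real.sinh ε)) else 0 := by
  have hm : MeasurableSet {z | vec z u ∈ flowBox univ l ε} :=
    (measurable_vec.comp measurable_prodMk_right) (measurableSet_flowBox MeasurableSet.univ l ε)
  split_ifs with hp
  · rw [volume_eq_volume_slopePt_preimage hm, Measure.volume_eq_prod,
      Measure.prod_apply (continuous_slopePt.measurable hm)]
    have hval : ∀ X : ℝ, (volume : Measure ℝ) (Prod.mk X ⁻¹' (slopePt ⁻¹'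
        {z | vec z u ∈ flowBox univ l ε})) =
        (Icc 0 ((u : ℂ).re * Real.sinh ε / (Real.cosh ε + (u : ℂ).im * Real.sinh ε))).indicator
          (fun _ => ENNReal.ofReal l) X := by
      intro X
      have hmem : ∀ η : ℝ, vec (slopePt (X, η)) u ∈ flowBox univ l ε ↔ ∃ t ∈ Icc 0 ε,
          X = (u : ℂ).re * Real.sinh t / (Real.cosh t + (u : ℂ).im * Real.sinh t) ∧
            η - Real.log (Real.cosh t + (u : ℂ).im * Real.sinh t) ∈ Ico 0 l := by
        intro η
        rw [mem_flowBox_iff]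
        simp only [base_vec, dir_vec, slopePt_re, slopePt_im, Real.log_exp, mem_univ, and_true, hp,
          true_and, mul_div_cancel_right₀ _ (Real.exp_pos η).ne']
      by_cases hX : X ∈ Icc 0 ((u : ℂ).re * Real.sinh ε / (Real.cosh ε + (u : ℂ).im * Real.sinh ε))
      · rw [indicator_of_mem hX]
        obtain ⟨t, ht, hXt⟩ := (mul_sinh_div_mem_iff hp hε X).mpr hX
        have : Prod.mk X ⁻¹' (slopePt ⁻¹' {z | vec z u ∈ flowBox univ l ε}) =
            Ico (Real.log (Real.cosh t + (u : ℂ).im * Real.sinh t))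
              (l + Real.log (Real.cosh t + (u : ℂ).im * Real.sinh t)) := by
          ext η
          rw [mem_preimage, mem_preimage, mem_ofPred_eq, hmem]
          constructor
          · rintro ⟨t', -, hXt', h⟩
            rw [mul_sinh_div_inj hp (hXt.symm.trans hXt')]
            exact ⟨by linarith [h.1], by linarith [h.2]⟩
          · intro h
            exact ⟨t, ht, hXt, by linarith [h.1], by linarith [h.2]⟩
        rw [this, Real.volume_Ico, add_sub_cancel_right]
      · rw [indicator_of_notMem hX]
        convert measure_empty (μ := (volume : Measure ℝ))
        refine eq_empty_of_forall_notMem fun η hη => hX ?_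
        obtain ⟨t, ht, h, -⟩ := (hmem η).mp hη
        exact (mul_sinh_div_mem_iff hp hε X).mp ⟨t, ht, h⟩
    simp only [hval]
    rw [lintegral_indicator_const measurableSet_Icc, Real.volume_Icc, sub_zero]
  · convert measure_empty (μ := (volume : Measure ℍ))
    refine eq_empty_of_forall_notMem fun z hz => hp ?_
    simpa using (mem_flowBox_iff.mp hz).1

theorem integral_cos_mul_sinh_div (ε : ℝ) :
    ∫ φ in (-(Real.pi / 2))..(Real.pi / 2),
      Real.cos φ * Real.sinh ε / (Real.cosh ε + Real.sin φ * Real.sinh ε) = 2 * ε := by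
  have hpos : ∀ φ : ℝ, 0 < Real.cosh ε + Real.sin φ * Real.sinh ε := by
    intro φ
    have := cosh_add_mul_sinh_pos ε (Circle.exp φ)
    rwa [Circle.coe_exp, Complex.exp_ofReal_mul_I_im] at this
  have hd : ∀ φ : ℝ, HasDerivAt (fun φ => Real.log (Real.cosh ε + Real.sin φ * Real.sinh ε))
      (Real.cos φ * Real.sinh ε / (Real.cosh ε + Real.sin φ * Real.sinh ε)) φ := by
    intro φ
    have h := ((Real.hasDerivAt_sin φ).mul_const (Real.sinh ε)).const_add (Real.cosh ε)
    exact h.log (hpos φ).ne'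
  rw [intervalIntegral.integral_eq_sub_of_hasDerivAt (fun φ _ => hd φ)]
  · rw [Real.sin_neg, Real.sin_pi_div_two, one_mul, neg_one_mul, Real.cosh_add_sinh, ← sub_eq_add_neg,
      Real.cosh_sub_sinh, Real.log_exp, Real.log_exp]
    ring
  · refine Continuous.intervalIntegrable (Continuous.div₀ ?_ ?_ fun φ => (hpos φ).ne') _ _ <;>
      fun_prop

/-- The Liouville measure of a flow box of length `l` and height `ε` is `2 l ε`. -/
theorem liouvillePlane_flowBox_univ {l ε : ℝ} (hl : 0 ≤ l) (hε : 0 ≤ ε) :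
    liouvillePlane (flowBox univ l ε) = ENNReal.ofReal (2 * l * ε) := by
  have hm := measurableSet_flowBox (E := univ) MeasurableSet.univ l ε
  have hmap : Measurable fun q : ℍ × ℝ => vec q.1 (Circle.exp q.2) :=
    measurable_vec.comp (measurable_id.prodMap measurable_circleExp)
  rw [liouvillePlane, Measure.map_apply hmap hm, Measure.prod_apply_symm (hmap hm)]
  have hcos : ∀ φ : ℝ, φ ∈ Ioc (-Real.pi) Real.pi →
      (0 < Real.cos φ ↔ φ ∈ Ioo (-(Real.pi / 2)) (Real.pi / 2)) := by
    intro φ hφ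
    refine ⟨fun h => ?_, Real.cos_pos_of_mem_Ioo⟩
    by_contra hn
    rw [mem_Ioo, not_and_or, not_lt, not_lt] at hn
    rcases hn with hn | hn
    · have := Real.cos_nonpos_of_pi_div_two_le_of_le (x := -φ) (by linarith) (by linarith [hφ.1])
      rw [Real.cos_neg] at this
      linarith
    · have := Real.cos_nonpos_of_pi_div_two_le_of_le hn (by linarith [hφ.2])
      linarith
  set F : ℝ → ℝ := fun φ => Real.cos φ * Real.sinh ε / (Real.cosh ε + Real.sin φ * Real.sinh ε)
  have hslice : ∀ φ ∈ Ioc (-Real.pi) Real.pi, (volume : Measure ℍ) ((fun z => (z, φ)) ⁻¹'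
      ((fun q : ℍ × ℝ => vec q.1 (Circle.exp q.2)) ⁻¹' flowBox univ l ε)) =
      (Ioo (-(Real.pi / 2)) (Real.pi / 2)).indicator
        (fun φ => ENNReal.ofReal l * ENNReal.ofReal (F φ)) φ := by
    intro φ hφ
    refine (volume_slice_flowBox hε (Circle.exp φ)).trans ?_
    rw [Circle.coe_exp, Complex.exp_ofReal_mul_I_re, Complex.exp_ofReal_mul_I_im]
    by_cases h : φ ∈ Ioo (-(Real.pi / 2)) (Real.pi / 2)
    · rw [if_pos ((hcos φ hφ).mpr h), indicator_of_mem h]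
    · rw [if_neg (fun h' => h ((hcos φ hφ).mp h')), indicator_of_notMem h]
  have hsub : Ioo (-(Real.pi / 2)) (Real.pi / 2) ⊆ Ioc (-Real.pi) Real.pi := fun φ h =>
    ⟨by linarith [h.1, Real.pi_pos], by linarith [h.2, Real.pi_pos]⟩
  have hpos : ∀ φ : ℝ, 0 < Real.cosh ε + Real.sin φ * Real.sinh ε := by
    intro φ
    have := cosh_add_mul_sinh_pos ε (Circle.exp φ)
    rwa [Circle.coe_exp, Complex.exp_ofReal_mul_I_im] at this
  have hFc : Continuous F := by
    refine Continuous.div₀ ?_ ?_ fun φ => (hpos φ).ne' <;> fun_prop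
  have hle : -(Real.pi / 2) ≤ Real.pi / 2 := by linarith [Real.pi_pos]
  have hF0 : ∀ φ ∈ Ioo (-(Real.pi / 2)) (Real.pi / 2), 0 ≤ F φ := fun φ h =>
    div_nonneg (mul_nonneg (Real.cos_pos_of_mem_Ioo h).le (Real.sinh_nonneg_iff.mpr hε)) (hpos φ).le
  rw [setLIntegral_congr_fun measurableSet_Ioc hslice, lintegral_indicator measurableSet_Ioo,
    Measure.restrict_restrict measurableSet_Ioo, inter_eq_self_of_subset_left hsub,
    lintegral_const_mul _ (by fun_prop), ← ofReal_integral_eq_lintegral_ofReal]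
  · rw [← integral_Ioc_eq_integral_Ioo, ← intervalIntegral.integral_of_le hle,
      integral_cos_mul_sinh_div, ← ENNReal.ofReal_mul hl]
    congr 1
    ring
  · exact (hFc.integrableOn_Icc).mono_set Ioo_subset_Icc_self
  · exact (ae_restrict_iff' measurableSet_Ioo).mpr (Filter.Eventually.of_forall hF0)

/-! ### Frames along a simple closed geodesic -/

theorem rotK_pi_div_two_inv_smul_re (z : ℍ) :
    ((rotK (Real.pi / 2))⁻¹ • z).re = -z.re / Complex.normSq z := by
  rw [← UpperHalfPlane.coe_re, coe_smul, den, Complex.div_re]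
  simp [SL_inv_apply]

theorem rotK_pi_div_two_smul_axisPt (t : ℝ) : rotK (Real.pi / 2) • axisPt t = axisPt (-t) := by
  obtain ⟨h1, h2, -⟩ := smul_axisPt (rotK (Real.pi / 2)) t
  refine UpperHalfPlane.ext_re_im ?_ ?_
  · rw [h1]; simp
  · rw [h2, axisPt_im, Real.exp_neg]
    simp
    field_simp

theorem rotK_pi_div_two_mul_diagA (t : ℝ) :
    rotK (Real.pi / 2) * diagA t = diagA (-t) * rotK (Real.pi / 2) := by
  ext i j
  rw [SL_mul_apply, SL_mul_apply]
  fin_cases i <;> fin_cases j <;> simp [neg_div]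

instance : IsIsometricSMul PSL(2, ℝ) ℍ where
  isometry_smul g := by
    induction g using QuotientGroup.induction_on with
    | H g => exact isometry_smul ℍ g

/-- The translation by `t` along the image of the imaginary axis under `k`. -/
def translation (k : PSL(2, ℝ)) (t : ℝ) : PSL(2, ℝ) := k * ((diagA t : SL(2, ℝ)) : PSL(2, ℝ)) * k⁻¹

theorem translation_add (k : PSL(2, ℝ)) (s t : ℝ) :
    translation k (s + t) = translation k s * translation k t := by
  rw [translation, translation, translation, diagA_add, QuotientGroup.mk_mul]
  group

theorem translation_zero (k : PSL(2, ℝ)) : translation k 0 = 1 := by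
  simp [translation, diagA_zero]

theorem translation_smul (k : PSL(2, ℝ)) (t : ℝ) (z : ℍ) :
    translation k t • k • z = k • diagA t • z := by
  rw [translation, mul_smul, mul_smul, inv_smul_smul, mk_smul]

/-- The isometry `k` carries the imaginary axis to the lift `axis v` of a simple closed geodesic of
length `l`: the translations by multiples of `l` along this lift belong to `G`, and every other
element of `G` maps the lift to a geodesic whose distance from it is at least the collar width. -/
structure IsCollarFrame (G : Subgroup PSL(2, ℝ)) (v : UnitTangent) (l : ℝ) (k : PSL(2, ℝ)) :
    Prop where
  length_pos : 0 < l
  axis_eq : axis v = range fun s => k • axisPt s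
  translation_mem : ∀ n : ℤ, translation k (n * l) ∈ G
  eq_translation : ∀ g ∈ G, ∀ s t, dist (k • axisPt s) (g • k • axisPt t) < collarWidth l →
    ∃ n : ℤ, g = translation k (n * l)

theorem exists_sub_int_mul_mem_Ico {l : ℝ} (hl : 0 < l) (x : ℝ) :
    ∃ n : ℤ, x - n * l ∈ Ico 0 l := by
  have h1 := Int.floor_le (x / l)
  have h2 := Int.lt_floor_add_one (x / l)
  rw [le_div_iff₀ hl] at h1
  rw [div_lt_iff₀ hl] at h2
  exact ⟨⌊x / l⌋, by linarith, by linarith⟩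

theorem proj_eq_iff {G : Subgroup PSL(2, ℝ)} {z w : ℍ} :
    proj G z = proj G w ↔ ∃ g ∈ G, g • w = z := by
  constructor
  · intro h
    obtain ⟨g, hg⟩ := Quotient.exact h
    exact ⟨g, g.2, hg⟩
  · rintro ⟨g, hg, h⟩
    exact Quotient.sound ⟨⟨g, hg⟩, h⟩

/-- The frame at the generating vector. The collar lemma applies because two points of the axis that
are equivalent under `G` differ by a translation along the axis. -/
theorem exists_isCollarFrame {G : Subgroup PSL(2, ℝ)} [DiscreteTopology G] {v : UnitTangent}
    {l : ℝ} (h : IsSimpleClosedGeodesic G v l) : ∃ k, IsCollarFrame G v l k := by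
  obtain ⟨k, hk⟩ := MulAction.exists_smul_eq PSL(2, ℝ) upI v
  have hl := h.length_pos
  have hb : ∀ s, base (flow s v) = k • axisPt s := fun s => by
    rw [← hk, flow_smul, base_smul, axisPt]
  have hA : translation k l ∈ G := by
    obtain ⟨g, hg, hgv⟩ := tangentProj_eq_iff.mp
      ((surfaceFlow_tangentProj G l v).symm.trans h.closed)
    rw [← hk, flow_smul_upI, ← mul_smul] at hgv
    rw [translation, ← smul_left_injective upI hgv, mul_inv_cancel_right]
    exact hg
  have hz : ∀ n : ℤ, translation k (n * l) ∈ G := by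
    intro n
    rw [translation, ← mk_diagA_zpow, ← conj_zpow]
    exact G.zpow_mem hA n
  refine ⟨k, hl, by ext z; simp only [axis, hb], hz, ?_⟩
  obtain ⟨U, hU, hU1⟩ := isOpen_induced_iff.mp (isOpen_discrete ({1} : Set G))
  have hU' : ∀ g : G, (g : PSL(2, ℝ)) ∈ U ↔ g = 1 := fun g => by
    rw [← mem_singleton_iff, ← hU1, mem_preimage]
  set Γ : Subgroup PSL(2, ℝ) := G.comap (MulAut.conj k).toMonoidHom with hΓ
  have hmem : ∀ g, g ∈ Γ ↔ k * g * k⁻¹ ∈ G := fun g => Iff.rfl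
  have hone : ∀ g, k * g * k⁻¹ = 1 → g = 1 := fun g hg => by
    rwa [conj_eq_one_iff] at hg
  have hN : (fun g => k * g * k⁻¹) ⁻¹' U ∈ 𝓝 (1 : PSL(2, ℝ)) := by
    refine (hU.preimage (by fun_prop)).mem_nhds ?_
    rw [mem_preimage, mul_one, mul_inv_cancel]
    exact (hU' 1).mpr rfl
  have hsimple : ∀ g ∈ Γ, ∀ s t, g • axisPt t = axisPt s →
      ∃ n : ℤ, g = ((diagA (n * l) : SL(2, ℝ)) : PSL(2, ℝ)) := by
    intro g hg s t hgt
    -- Translate both points into the fundamental segment.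
    obtain ⟨n, hn⟩ := exists_sub_int_mul_mem_Ico hl s
    obtain ⟨m, hm⟩ := exists_sub_int_mul_mem_Ico hl t
    set γ : PSL(2, ℝ) := translation k (-n * l) * (k * g * k⁻¹) * translation k (m * l) with hγ
    have hγG : γ ∈ G := by
      refine G.mul_mem (G.mul_mem ?_ ((hmem g).mp hg)) (hz m)
      have := hz (-n)
      rwa [Int.cast_neg] at this
    have hγs : γ • base (flow (t - m * l) v) = base (flow (s - n * l) v) := by
      rw [hb, hb, hγ, mul_smul, mul_smul, translation_smul, diagA_smul_axisPt, mul_smul, mul_smul,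
        inv_smul_smul, add_sub_cancel, hgt, translation_smul, diagA_smul_axisPt]
      congr 2
      ring
    have hst : t - m * l = s - n * l :=
      h.simple hm hn (proj_eq_iff.mpr ⟨γ, hγG, hγs⟩).symm
    rw [hst] at hγs
    have h1 := h.regular _ γ hγG hγs
    have h2 : k * g * k⁻¹ = translation k ((n - m : ℤ) * l) := by
      have e1 : translation k (n * l) * translation k (-n * l) = 1 := by
        rw [← translation_add, ← translation_zero k]; congr 1; ring
      have e2 : translation k (m * l) * translation k (-m * l) = 1 := by
        rw [← translation_add, ← translation_zero k]; congr 1; ring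
      calc k * g * k⁻¹ = (translation k (n * l) * translation k (-n * l)) * (k * g * k⁻¹) *
            (translation k (m * l) * translation k (-m * l)) := by rw [e1, e2, one_mul, mul_one]
        _ = translation k (n * l) * γ * translation k (-m * l) := by rw [hγ]; group
        _ = _ := by
          rw [h1, mul_one, ← translation_add]
          congr 1
          push_cast
          ring
    refine ⟨n - m, ?_⟩
    rw [translation] at h2
    exact mul_left_cancel (mul_right_cancel h2)
  intro g hg s t hd
  have hd' : dist (axisPt s) ((k⁻¹ * g * k) • axisPt t) < collarWidth l := by
    rwa [← dist_smul k, mul_assoc, mul_smul, smul_inv_smul, mul_smul]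
  have hgk : k * (k⁻¹ * g * k) * k⁻¹ = g := by group
  obtain ⟨n, hn⟩ := mem_zpowers_of_dist_lt (Γ := Γ) hN
    (fun g hg hgU => hone g (congrArg Subtype.val ((hU' ⟨_, hg⟩).mp hgU))) hl hA hsimple
    ((hmem _).mpr (hgk.symm ▸ hg)) hd'
  exact ⟨n, by rw [translation, ← hn, hgk]⟩

/-- The half-turn about `i` exchanges the two sides of the imaginary axis. -/
theorem IsCollarFrame.flip {G : Subgroup PSL(2, ℝ)} {v : UnitTangent} {l : ℝ} {k : PSL(2, ℝ)}
    (h : IsCollarFrame G v l k) :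
    IsCollarFrame G v l (k * ((rotK (Real.pi / 2) : SL(2, ℝ)) : PSL(2, ℝ))) := by
  have hs : ∀ s, (k * ((rotK (Real.pi / 2) : SL(2, ℝ)) : PSL(2, ℝ))) • axisPt s =
      k • axisPt (-s) := fun s => by
    rw [mul_smul, mk_smul, rotK_pi_div_two_smul_axisPt]
  have ht : ∀ t, translation (k * ((rotK (Real.pi / 2) : SL(2, ℝ)) : PSL(2, ℝ))) t =
      translation k (-t) := fun t => by
    rw [translation, translation, mul_assoc k, ← QuotientGroup.mk_mul, rotK_pi_div_two_mul_diagA,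
      QuotientGroup.mk_mul]
    group
  refine ⟨h.length_pos, ?_, fun n => ?_, fun g hg s t hd => ?_⟩
  · rw [h.axis_eq]
    simp only [hs]
    exact ((Equiv.neg ℝ).surjective.range_comp fun s => k • axisPt s).symm
  · rw [ht, ← neg_mul, ← Int.cast_neg]
    exact h.translation_mem (-n)
  · rw [hs, hs] at hd
    obtain ⟨n, hn⟩ := h.eq_translation g hg _ _ hd
    refine ⟨-n, ?_⟩
    rw [ht, hn]
    congr 1
    push_cast
    ring

/-- A frame can be chosen such that a given point off the geodesic lies to the right of it. -/
theorem exists_isCollarFrame_side {G : Subgroup PSL(2, ℝ)} [DiscreteTopology G] {v : UnitTangent}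
    {l : ℝ} (h : IsSimpleClosedGeodesic G v l) {p : ℍ} (hp : p ∉ axis v) :
    ∃ k, IsCollarFrame G v l k ∧ 0 < (k⁻¹ • p).re := by
  obtain ⟨k, hk⟩ := exists_isCollarFrame h
  rcases lt_trichotomy (k⁻¹ • p).re 0 with h0 | h0 | h0
  · refine ⟨_, hk.flip, ?_⟩
    rw [mul_inv_rev, mul_smul, ← QuotientGroup.mk_inv, mk_smul, rotK_pi_div_two_inv_smul_re]
    exact div_pos (neg_pos.mpr h0) (Complex.normSq_pos.mpr (UpperHalfPlane.ne_zero _))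
  · refine absurd ?_ hp
    rw [hk.axis_eq]
    exact ⟨Real.log (k⁻¹ • p).im, (inv_smul_eq_iff.mp (eq_axisPt h0)).symm⟩
  · exact ⟨k, hk, h0⟩

theorem IsCollarFrame.mem_axis_iff {G : Subgroup PSL(2, ℝ)} {v : UnitTangent} {l : ℝ}
    {k : PSL(2, ℝ)} (h : IsCollarFrame G v l k) (z : ℍ) : z ∈ axis v ↔ (k⁻¹ • z).re = 0 := by
  rw [h.axis_eq]
  constructor
  · rintro ⟨s, rfl⟩
    rw [inv_smul_smul, axisPt_re]
  · exact fun h0 => ⟨Real.log (k⁻¹ • z).im, (inv_smul_eq_iff.mp (eq_axisPt h0)).symm⟩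

theorem isPreconnected_re_pos : IsPreconnected {z : ℍ | 0 < z.re} := by
  rw [← UpperHalfPlane.isEmbedding_coe.isInducing.isPreconnected_image]
  have : ((↑) : ℍ → ℂ) '' {z : ℍ | 0 < z.re} = {z : ℂ | 0 < z.re} ∩ {z : ℂ | 0 < z.im} := by
    ext z
    constructor
    · rintro ⟨w, hw, rfl⟩
      exact ⟨hw, w.im_pos⟩
    · rintro ⟨h1, h2⟩
      exact ⟨⟨z, h2⟩, h1, rfl⟩
  rw [this]
  exact ((convex_halfSpace_re_gt 0).inter (convex_halfSpace_im_gt 0)).isPreconnected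

theorem IsCollarFrame.halfPlane_eq {G : Subgroup PSL(2, ℝ)} {v : UnitTangent} {l : ℝ}
    {k : PSL(2, ℝ)} (h : IsCollarFrame G v l k) {p : ℍ} (hp : 0 < (k⁻¹ • p).re) :
    halfPlane v p = {z | 0 < (k⁻¹ • z).re} := by
  refine Subset.antisymm (fun z hz => ?_) ?_
  · have hc : Continuous fun z : ℍ => (k⁻¹ • z).re :=
      UpperHalfPlane.continuous_re.comp (continuous_const_smul k⁻¹)
    by_contra hn
    have hpF : p ∈ (axis v)ᶜ := fun hpa => hp.ne' ((h.mem_axis_iff p).mp hpa)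
    obtain ⟨w, hw, hw0⟩ := isPreconnected_connectedComponentIn.intermediate_value hz
      (mem_connectedComponentIn hpF) hc.continuousOn ⟨not_lt.mp hn, hp.le⟩
    exact connectedComponentIn_subset _ _ hw ((h.mem_axis_iff w).mpr hw0)
  · refine IsPreconnected.subset_connectedComponentIn ?_ hp fun z hz hza =>
      (show 0 < (k⁻¹ • z).re from hz).ne' ((h.mem_axis_iff z).mp hza)
    have : {z : ℍ | 0 < (k⁻¹ • z).re} = (fun z => k • z) '' {z : ℍ | 0 < z.re} := by
      ext z
      constructor
      · exact fun hz => ⟨k⁻¹ • z, hz, smul_inv_smul k z⟩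
      · rintro ⟨w, hw, rfl⟩
        simpa using hw
    rw [this]
    exact isPreconnected_re_pos.image _ (continuous_const_smul k).continuousOn

/-! ### The thickened section as the image of a flow box -/

theorem diagA_smul_re (t : ℝ) (z : ℍ) : (diagA t • z).re = Real.exp t * z.re := by
  have h : Real.exp t = Real.exp (t / 2) / Real.exp (-(t / 2)) := by
    rw [← Real.exp_sub]; congr 1; ring
  rw [← UpperHalfPlane.coe_re, coe_smul, den, h]
  simp only [diagA_apply, Matrix.of_apply, Matrix.cons_val', Matrix.cons_val_zero,
    Matrix.cons_val_one, Matrix.cons_val_fin_one, Complex.ofReal_zero, zero_mul, zero_add,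
    add_zero, Complex.div_ofReal_re, Complex.re_ofReal_mul, UpperHalfPlane.coe_re]
  ring

theorem diagA_smul_vec (t : ℝ) (z : ℍ) (u : Circle) : diagA t • vec z u = vec (diagA t • z) u := by
  refine UnitTangent.ext rfl ?_
  have h : den (diagA t) z = (Real.exp (-(t / 2)) : ℝ) := by
    simp [den]
  rw [dir_smul_SL, base_vec, h, Complex.conj_ofReal, div_self, mul_one, dir_vec, dir_vec]
  exact_mod_cast (Real.exp_pos _).ne'

theorem translation_smul_tangent (k : PSL(2, ℝ)) (t : ℝ) (w : UnitTangent) :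
    translation k t • k • w = k • diagA t • w := by
  rw [translation, mul_smul, mul_smul, inv_smul_smul, mk_smul_tangent]

/-- For positive times, the geodesic generated by a vector on the imaginary axis lies on the side
to which the vector points. -/
theorem re_base_flow_axisPt_pos_iff {t : ℝ} (ht : 0 < t) (s : ℝ) (u : Circle) :
    0 < (base (flow t (vec (axisPt s) u))).re ↔ 0 < (u : ℂ).re := by
  have h := re_div_im_flow_axisPt s t u _ rfl
  have h1 := (base (flow t (vec (axisPt s) u))).im_pos
  rw [← div_pos_iff_of_pos_right h1, h,
    div_pos_iff_of_pos_right (cosh_add_mul_sinh_pos t _),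
    mul_pos_iff_of_pos_right (Real.sinh_pos_iff.mpr ht), ← dir_re_pos_of_flow t rfl, dir_vec]

theorem surfaceBase_tangentProj (G : Subgroup PSL(2, ℝ)) (w : UnitTangent) :
    surfaceBase G (tangentProj G w) = proj G (base w) := rfl

variable {G : Subgroup PSL(2, ℝ)} {v : UnitTangent} {l : ℝ} {k : PSL(2, ℝ)}

/-- Every vector of `T₁S` that is based on the geodesic lifts to a vector based on the fundamental
segment of the axis. -/
theorem IsCollarFrame.exists_lift (h : IsCollarFrame G v l k) {w : SurfaceTangent G}
    (hw : surfaceBase G w ∈ geodesic G v) :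
    ∃ s ∈ Ico 0 l, ∃ u, w = tangentProj G (k • vec (axisPt s) u) := by
  obtain ⟨x, rfl⟩ := tangentProj_surjective G w
  rw [surfaceBase_tangentProj, geodesic, h.axis_eq] at hw
  obtain ⟨_, ⟨s, rfl⟩, hs⟩ := hw
  obtain ⟨g, hg, hgs⟩ := proj_eq_iff.mp hs
  obtain ⟨n, hn⟩ := exists_sub_int_mul_mem_Ico h.length_pos s
  have hgs' : g • base x = k • axisPt s := hgs
  set y : UnitTangent := k⁻¹ • translation k (-n * l) • g • x with hy
  have hyb : base y = axisPt (s - n * l) := by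
    rw [hy, base_smul, base_smul, base_smul, hgs', translation_smul, inv_smul_smul,
      diagA_smul_axisPt]
    congr 1
    ring
  refine ⟨_, hn, dir y, ?_⟩
  have hyv : vec (axisPt (s - n * l)) (dir y) = y := UnitTangent.ext hyb.symm rfl
  have hT := h.translation_mem (-n)
  rw [Int.cast_neg] at hT
  rw [hyv, hy, smul_inv_smul, tangentProj_smul hT, tangentProj_smul hg]

theorem IsCollarFrame.mem_inwardVectors_iff (h : IsCollarFrame G v l k) {p : ℍ}
    (hp : 0 < (k⁻¹ • p).re) {r : ℝ} (hr : 0 < r) (hrl : r < collarWidth l)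
    {w : SurfaceTangent G} : w ∈ inwardVectors G v p r ↔ ∃ s ∈ Ico 0 l, ∃ u : Circle,
      0 < (u : ℂ).re ∧ w = tangentProj G (k • vec (axisPt s) u) := by
  have hcollar : ∀ z, z ∈ halfPlane v p ∩ Metric.thickening r (axis v) ↔
      0 < (k⁻¹ • z).re ∧ ∃ s, dist z (k • axisPt s) < r := fun z => by
    rw [h.halfPlane_eq hp, h.axis_eq, mem_inter_iff, Metric.mem_thickening_iff, mem_ofPred_eq,
      exists_range_iff]
  constructor
  · rintro ⟨hb, τ, hτ, hw⟩
    obtain ⟨s, hs, u, rfl⟩ := h.exists_lift hb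
    refine ⟨s, hs, u, ?_, rfl⟩
    -- A time so short that the collar lemma applies.
    obtain ⟨t, ht0, ht⟩ := exists_between (lt_min hτ (sub_pos.mpr hrl))
    obtain ⟨htτ, htr⟩ := lt_min_iff.mp ht
    have hmem := hw t ht0 htτ
    rw [surfaceFlow_tangentProj, surfaceBase_tangentProj, flow_smul, base_smul] at hmem
    obtain ⟨z, hz, hzp⟩ := hmem
    obtain ⟨hzr, s', hs'⟩ := (hcollar z).mp hz
    obtain ⟨g, hg, hgz⟩ := proj_eq_iff.mp hzp.symm
    set x := flow t (vec (axisPt s) u) with hx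
    have hd1 : dist (axisPt s) (base x) = t := by
      have := dist_base_flow 0 t (vec (axisPt s) u)
      rwa [flow_zero, base_vec, zero_sub, abs_neg, abs_of_pos ht0] at this
    have hd : dist (k • axisPt s) (g • k • axisPt s') < collarWidth l := by
      calc dist (k • axisPt s) (g • k • axisPt s')
          ≤ dist (k • axisPt s) (k • base x) + dist (k • base x) (g • k • axisPt s') :=
            dist_triangle _ _ _
        _ = t + dist z (k • axisPt s') := by rw [dist_smul, hd1, ← hgz, dist_smul]
        _ < collarWidth l := by linarith
    obtain ⟨n, rfl⟩ := h.eq_translation g hg _ _ hd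
    rw [← smul_inv_smul k z, translation_smul, smul_left_cancel_iff] at hgz
    rw [← re_base_flow_axisPt_pos_iff ht0 s u, ← hx, ← hgz, diagA_smul_re]
    exact mul_pos (Real.exp_pos _) hzr
  · rintro ⟨s, -, u, hu, rfl⟩
    refine ⟨⟨k • axisPt s, ?_, ?_⟩, r, hr, fun t ht htr => ⟨k • base (flow t (vec (axisPt s) u)),
      (hcollar _).mpr ⟨?_, s, ?_⟩, ?_⟩⟩
    · rw [h.axis_eq]
      exact mem_range_self s
    · rw [surfaceBase_tangentProj, base_smul, base_vec]
    · rw [inv_smul_smul]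
      exact (re_base_flow_axisPt_pos_iff ht s u).mpr hu
    · have := dist_base_flow t 0 (vec (axisPt s) u)
      rw [flow_zero, base_vec, sub_zero, abs_of_pos ht] at this
      rwa [dist_smul, this]
    · rw [surfaceFlow_tangentProj, surfaceBase_tangentProj, flow_smul, base_smul]

theorem IsCollarFrame.thickenedSection_eq (h : IsCollarFrame G v l k) {p : ℍ}
    (hp : 0 < (k⁻¹ • p).re) {r : ℝ} (hr : 0 < r) (hrl : r < collarWidth l) (ε : ℝ) :
    thickenedSection G v p r ε = tangentProj G '' ((fun x => k • x) ''
      flowBox ((fun x => k • x) ⁻¹' liftedDenseOrbits G) l ε) := by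
  rw [image_image]
  ext w
  constructor
  · rintro ⟨t, ht, w₀, ⟨hin, hE⟩, rfl⟩
    obtain ⟨s, hs, u, hu, rfl⟩ := (h.mem_inwardVectors_iff hp hr hrl).mp hin
    exact ⟨_, ⟨s, hs, u, hu, hE, t, ht, rfl⟩, by rw [surfaceFlow_tangentProj, flow_smul]⟩
  · rintro ⟨_, ⟨s, hs, u, hu, hE, t, ht, rfl⟩, rfl⟩
    refine ⟨t, ht, _, ⟨(h.mem_inwardVectors_iff hp hr hrl).mpr ⟨s, hs, u, hu, rfl⟩, hE⟩, ?_⟩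
    rw [surfaceFlow_tangentProj, flow_smul]

/-- Below the collar width, the flow box embeds into `T₁S`. -/
theorem IsCollarFrame.injOn_flowBox (h : IsCollarFrame G v l k) (E : Set UnitTangent) {ε : ℝ}
    (hε : ε < collarWidth l) :
    InjOn (tangentProj G) ((fun x => k • x) '' flowBox E l ε) := by
  rintro _ ⟨_, ⟨s, hs, u, hu, -, t, ht, rfl⟩, rfl⟩ _ ⟨_, ⟨s', hs', u', hu', -, t', ht', rfl⟩, rfl⟩
    heq
  obtain ⟨g, hg, hgx⟩ := tangentProj_eq_iff.mp heq
  dsimp only at hgx ⊢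
  -- Only the difference of the two flow times matters for the distance on the axis.
  have hflow : flow (t' - t) (g • k • vec (axisPt s') u') = k • vec (axisPt s) u := by
    rw [← flow_smul, ← flow_smul, ← flow_smul] at hgx
    rw [sub_eq_add_neg, add_comm, flow_add, hgx, ← flow_add, neg_add_cancel, flow_zero]
  have hd : dist (k • axisPt s) (g • k • axisPt s') < collarWidth l := by
    have := dist_base_flow (t' - t) 0 (g • k • vec (axisPt s') u')
    rw [hflow, flow_zero, base_smul, base_smul, base_smul, base_vec, base_vec, sub_zero] at this
    rw [this]
    exact (abs_sub_le_iff.mpr ⟨by linarith [ht.1, ht'.2], by linarith [ht'.1, ht.2]⟩).trans_lt hε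
  obtain ⟨n, rfl⟩ := h.eq_translation g hg _ _ hd
  rw [translation_smul_tangent, smul_left_cancel_iff, ← mk_smul_tangent, ← flow_smul,
    mk_smul_tangent, diagA_smul_vec, diagA_smul_axisPt] at hgx
  obtain ⟨hss, rfl, rfl⟩ := flow_axisPt_inj hu' hgx
  have hn : n = 0 := by
    have h1 : (n : ℝ) < 1 := by nlinarith [hs.1, hs.2, hs'.1, hs'.2, h.length_pos]
    have h2 : (-1 : ℝ) < n := by nlinarith [hs.1, hs.2, hs'.1, hs'.2, h.length_pos]
    have h1' : n < 1 := by exact_mod_cast h1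
    have h2' : -1 < n := by exact_mod_cast h2
    omega
  rw [hn, Int.cast_zero, zero_mul, zero_add] at hss
  rw [hss]

/-! ### The measure of the thickened section -/

/-- A vector whose forward orbit enters the forward orbit of a vector with dense forward orbit has
dense forward orbit itself. -/
theorem mem_liftedDenseOrbits_of_flow {t : ℝ} (ht : 0 ≤ t) {w : UnitTangent}
    (hw : flow t w ∈ liftedDenseOrbits G) : w ∈ liftedDenseOrbits G := by
  refine Dense.mono ?_ (show Dense _ from hw)
  rintro _ ⟨s, hs, rfl⟩
  refine ⟨s + t, add_pos_of_pos_of_nonneg hs ht, ?_⟩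
  simp only [surfaceFlow_tangentProj, flow_add]

/-- The restriction to dense forward orbits does not change the measure of a flow box: a vector of the
box with dense forward orbit comes from a vector on the axis with dense forward orbit. -/
theorem liouvillePlane_flowBox [DiscreteTopology G] (hG : area G ≠ ⊤) (k : PSL(2, ℝ)) {l ε : ℝ}
    (hl : 0 ≤ l) (hε : 0 ≤ ε) :
    liouvillePlane (flowBox ((fun x => k • x) ⁻¹' liftedDenseOrbits G) l ε) =
      ENNReal.ofReal (2 * l * ε) := by
  rw [← liouvillePlane_flowBox_univ hl hε]
  refine measure_congr (Filter.EventuallyLE.antisymm (Filter.Eventually.of_forall ?_) ?_)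
  · rintro _ ⟨s, hs, u, hu, -, t, ht, rfl⟩
    exact ⟨s, hs, u, hu, mem_univ _, t, ht, rfl⟩
  · filter_upwards [(measurePreserving_smul k liouvillePlane).quasiMeasurePreserving.ae
      (ae_mem_liftedDenseOrbits hG)] with x hx
    rintro ⟨s, hs, u, hu, -, t, ht, rfl⟩
    refine ⟨s, hs, u, hu, mem_liftedDenseOrbits_of_flow ht.1 ?_, t, ht, rfl⟩
    rwa [flow_smul]

theorem measurableSet_tangentProj_image [DiscreteTopology G] {U : Set UnitTangent}
    (hU : MeasurableSet U) : MeasurableSet (tangentProj G '' U) := by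
  have := countable_of_discrete G
  change MeasurableSet (tangentProj G ⁻¹' (tangentProj G '' U))
  have hpre : tangentProj G ⁻¹' (tangentProj G '' U) = ⋃ g : G, (fun x => g • x) ⁻¹' U := by
    ext x
    simp only [mem_preimage, mem_image, mem_iUnion]
    constructor
    · rintro ⟨y, hy, hyx⟩
      obtain ⟨g, hg, rfl⟩ := tangentProj_eq_iff.mp hyx
      exact ⟨⟨g, hg⟩, hy⟩
    · rintro ⟨g, hg⟩
      exact ⟨g • x, hg, tangentProj_smul g.2 x⟩
  rw [hpre]
  exact MeasurableSet.iUnion fun g => (continuous_const_smul g).measurable hU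

/-- Otherwise the hyperbolic plane would be a countable union of null sets. -/
theorem area_ne_zero (G : Subgroup PSL(2, ℝ)) [DiscreteTopology G] : area G ≠ 0 := by
  have := countable_of_discrete G
  obtain ⟨F, hFm, hF, hFae⟩ := exists_domain G
  intro h0
  have hF0 : volume F = 0 := by
    rw [← quotientMeasure_image (G := G) volume hFm (injOn_mk_of_forall_smul_notMem hF)]
    exact measure_mono_null (subset_univ _) h0
  have hcover : ∀ᵐ z : ℍ, ∀ g : G, g • z ∉ F := ae_all_iff.mpr fun g =>
    measure_eq_zero_iff_ae_notMem.mp ((measure_preimage_smul volume (g : PSL(2, ℝ)) F).trans hF0)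
  have hne : (volume : Measure ℍ) ≠ 0 := fun h =>
    (volume_pos_of_isOpen isOpen_univ univ_nonempty).ne' (by rw [h]; rfl)
  have := ae_neBot.mpr hne
  obtain ⟨z, ⟨g, hg⟩, hz⟩ := (hFae.and hcover).exists
  exact hz g hg

end HypSurface

end

open MeasureTheory Set HypSurface in
theorem mainTheorem8 (G : Subgroup PSL(2, ℝ)) [DiscreteTopology G]
    (hG : HypSurface.area G ≠ ⊤)
    (v : HypSurface.UnitTangent) (l : ℝ) (hγ : HypSurface.IsSimpleClosedGeodesic G v l)
    (p : ℍ) (hp : p ∉ HypSurface.axis v)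
    (r ε : ℝ) (hr : 0 < r) (hε : 0 ≤ ε) (hεr : ε < HypSurface.collarWidth l - r) :
    MeasurableSet (HypSurface.thickenedSection G v p r ε) ∧
      HypSurface.liouville G (HypSurface.thickenedSection G v p r ε) =
        ENNReal.ofReal (ε * l / (Real.pi * (HypSurface.area G).toReal)) := by
  have := countable_of_discrete G
  obtain ⟨k, hk, hkp⟩ := exists_isCollarFrame_side hγ hp
  have hl := hk.length_pos
  have hEm := (continuous_const_smul k).measurable (measurableSet_liftedDenseOrbits G)
  set D := flowBox ((fun x => k • x) ⁻¹' liftedDenseOrbits G) l ε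
  have hD : MeasurableSet D := measurableSet_flowBox hEm l ε
  have himage : (fun x => k • x) '' D = (fun x => k⁻¹ • x) ⁻¹' D := by
    rw [image_smul, preimage_smul_inv]
  have hU : MeasurableSet ((fun x => k • x) '' D) := by
    rw [himage]
    exact (continuous_const_smul k⁻¹).measurable hD
  rw [hk.thickenedSection_eq hkp hr (by linarith) ε]
  refine ⟨measurableSet_tangentProj_image hU, ?_⟩
  have hmass : quotientMeasure G liouvillePlane (tangentProj G '' ((fun x => k • x) '' D)) =
      ENNReal.ofReal (2 * l * ε) := by
    refine (quotientMeasure_image liouvillePlane hU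
      (hk.injOn_flowBox _ (by linarith))).trans ?_
    rw [himage, measure_preimage_smul, liouvillePlane_flowBox hG k hl.le hε]
  have hpos := ENNReal.toReal_pos (area_ne_zero G) hG
  rw [liouville, Measure.smul_apply, hmass, smul_eq_mul, ← ENNReal.ofReal_toReal hG,
    ← ENNReal.ofReal_mul (by positivity), ← ENNReal.ofReal_inv_of_pos (by positivity),
    ← ENNReal.ofReal_mul (by positivity), ENNReal.toReal_ofReal hpos.le]
  congr 1
  field_simp
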